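/- Let $q\ge 1$ be a fixed integer. For each $n$ let $K_n\le P_n$ be non-negative integers and $p_n\in[0,1]$. The random graph $\mathbb{G}_q=\mathbb{G}_q(n,K_n,P_n,p_n)$ on $n$ nodes $v_1,\dots,v_n$ is defined as follows: the nodes receive independent key rings $S_1,\dots,S_n$, each uniformly distributed among all $K_n$-element subsets of a pool of $P_n$ keys; independently of these, each of the $\binom n2$ channels between two distinct nodes is on with probability $p_n$, independently of the others; and two distinct nodes $v_i,v_j$ are adjacent if and only if $|S_i\cap S_j|\ge q$ and the channel between them is on. Let $p_{e,q}=p_n\cdot\mathbb{P}[|S_i\cap S_j|\ge q]$ (for $i\ne j$) be the probability that two given distinct nodes are adjacent, and let $\delta$ be the minimum degree of $\mathbb{G}_q$. All limits are for $n\to\infty$. Suppose that $K_n\to\infty$ and $K_n^2/P_n\to 0$, and that there are a constant integer $k\ge 1$ and a real sequence $\alpha_n$ having a limit in $[-\infty,\infty]$ such that, for all sufficiently large $n$, $$p_{e,q}=\frac{\ln n+(k-1)\ln\ln n+\alpha_n}{n}.$$ Suppose moreover that, for all sufficiently large $n$, $\alpha_n=b\ln\ln n+\beta_n$, where $b$ is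 a constant integer and $\beta_n$ is a real sequence with $$-1<\liminf_{n\to\infty}\frac{\beta_n}{\ln\ln n}\le\limsup_{n\to\infty}\frac{\beta_n}{\ln\ln n}<1.$$ Then: 1. If $k+b\le 0$, then $\lim\mathbb{P}[\delta=0]=1$ and $\lim\mathbb{P}[\delta>0]=0$. If $k+b\ge 1$, then: 2. $\lim\mathbb{P}[\delta=k+b\text{ or }\delta=k+b-1]=1$; 3. if $\lim\beta_n=\beta^*\in(-\infty,\infty)$, then $\lim\mathbb{P}[\delta=k+b]=\exp\!\left(-\frac{e^{-\beta^*}}{(k+b-1)!}\right)$ and $\lim\mathbb{P}[\delta=k+b-1]=1-\exp\!\left(-\frac{e^{-\beta^*}}{(k+b-1)!}\right)$; 4. if $\lim\beta_n=\infty$, then $\lim\mathbb{P}[\delta=k+b]=1$ and $\lim\mathbb{P}[\delta\ne k+b]=0$; 5. if $\lim\beta_n=-\infty$, then $\lim\mathbb{P}[\delta=k+b-1]=1$ and $\lim\mathbb{P}[\delta\ne k+b-1]=0$. -/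

import Mathlib

open Filter Topology MeasureTheory ProbabilityTheory

noncomputable section

namespace QComposite

/-- The law of one key ring: uniform over all `K`-element subsets of a pool of `P` keys. -/
def keyRingLaw (P K : ℕ) : Measure (Finset (Fin P)) :=
  uniformOn {S : Finset (Fin P) | S.card = K}

/-- The graph of the `q`-composite key predistribution scheme: two distinct nodes are adjacent
when their key rings share at least `q` keys. -/
def keyGraph {n P : ℕ} (q : ℕ) (S : Fin n → Finset (Fin P)) : SimpleGraph (Fin n) where
  Adj i j := i ≠ j ∧ q ≤ (S i ∩ S j).card
  symm := ⟨fun i j h => ⟨h.1.symm, by rw [Finset.inter_comm]; exact h.2⟩⟩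
  loopless := ⟨fun _ h => h.1 rfl⟩

/-- An outcome of the model: the key rings of the `n` nodes, and the graph of the node-to-node
channels that are on. -/
abbrev Outcome (n P : ℕ) : Type := (Fin n → Finset (Fin P)) × SimpleGraph (Fin n)

/-- The law of the model: the key rings are independent and uniform, and, independently of
them, the channels form an Erdős–Rényi graph in which every channel is on with probability `p`,
independently of the others. -/
def networkLaw (n P K : ℕ) (p : unitInterval) : Measure (Outcome n P) :=
  (Measure.pi fun _ : Fin n => keyRingLaw P K).prod (SimpleGraph.binomialRandom (Fin n) p)

/-- The network graph `𝔾_q`: two distinct nodes are adjacent when they share at least `q` keys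
and the channel between them is on. -/
def networkGraph {n P : ℕ} (q : ℕ) (ω : Outcome n P) : SimpleGraph (Fin n) :=
  keyGraph q ω.1 ⊓ ω.2

open Classical in
/-- The minimum degree `δ` of the network graph. -/
def minDeg {n P : ℕ} (q : ℕ) (ω : Outcome n P) : ℕ :=
  (networkGraph q ω).minDegree

/-- `p_{s,q}`: the probability that two independent key rings share at least `q` keys. -/
def keyShareProb (P K q : ℕ) : ℝ :=
  ((keyRingLaw P K).prod (keyRingLaw P K)).real {x | q ≤ (x.1 ∩ x.2).card}

/-- `p_{e,q} = p · p_{s,q}`: the probability that two given distinct nodes are adjacent in the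
network graph. -/
def linkProb (P K q : ℕ) (p : unitInterval) : ℝ :=
  (p : ℝ) * keyShareProb P K q

end QComposite

end

/-! Write `l = k + b`, let `t` be the link probability and `x = n t`, which is asymptotic to `log
n`. The expected number of nodes of degree `h` is close to `n * exp (-x) * x ^ h / h!`, and
inserting the formula for `t` turns this into `exp ((h + 1 - l) * log log n - β n) / h!` up to a
factor `1 + o(1)` (`meanCount_eventually_eq`). Since `|β n|` is eventually at most `(1 - ε) * log
log n`, this diverges for `h ≥ l`, vanishes for `h ≤ l - 2`, and is governed by `-β n` alone at `h =
l - 1`. So for `l ≥ 1` the minimum degree is `l - 1` or `l` with probability tending to one, and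
which of the two depends on whether a node of degree `l - 1` exists; for `l ≤ 0` isolated nodes
exist.

Expectations become probabilities through binomial moments of the count: the `m`-th one is the sum,
over `m`-sets `V` of nodes, of the probability that all of `V` has degree `h`. `joint_upper` and
`joint_lower` show that this probability is `(1 + o(1)) * poissonMass h x ^ m` uniformly in `V`.
Truncated inclusion-exclusion (`tendsto_exp_neg_of_factorial_moments`) then gives the Poisson limit
when the mean converges, and a second moment bound (`real_eq_zero_le`) gives existence when it
diverges.

For the joint law, fix the key rings of `V`. The nodes outside `V` then choose their neighbourhoods
in `V` independently (`networkLaw_real_cutType`). The main contribution comes from choices in which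
no outer node has two neighbours in `V`; the correction is `pairSum`, controlled by `bothProb_le`
together with the fact that `(K ^ 2 / P) ^ q` is at most a constant times the sharing probability
(`shareProb_lower`). If the rings of `V` are pairwise disjoint, there are no edges inside `V` and
`pairSum` is of order `t ^ 2`. Otherwise the estimate may lose a factor exponential in `x * p / K`
times the total overlap; an exponential moment of the overlap (`sum_ringWeight_pow_inter_le`) and
`tendsto_exp_overlap` show that such ring families still contribute negligibly. -/

namespace QComposite

open Finset

/-! ### Uniformly distributed key rings -/

/-- The mass that the law of a key ring gives to one ring. -/
noncomputable def ringWeight (P K : ℕ) (x : Finset (Fin P)) : ℝ :=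
  if x.card = K then ((P.choose K : ℝ))⁻¹ else 0

lemma ringWeight_nonneg (P K : ℕ) (x : Finset (Fin P)) : 0 ≤ ringWeight P K x := by
  unfold ringWeight; split_ifs <;> positivity

lemma sum_ringWeight_mul (P K : ℕ) (f : Finset (Fin P) → ℝ) :
    ∑ x, ringWeight P K x * f x = ((P.choose K : ℝ))⁻¹ * ∑ x ∈ powersetCard K univ, f x := by
  rw [← univ_filter_card_eq, sum_filter, mul_sum]
  refine sum_congr rfl fun x _ => ?_
  unfold ringWeight; split_ifs <;> simp

lemma sum_ringWeight {P K : ℕ} (h : K ≤ P) : ∑ x, ringWeight P K x = 1 := by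
  have := sum_ringWeight_mul P K (fun _ => 1)
  simp only [mul_one] at this
  rw [this]
  have hc : (P.choose K : ℝ) ≠ 0 := by exact_mod_cast (Nat.choose_pos h).ne'
  simp [card_powersetCard, hc]

lemma card_powersetCard_filter_superset {P : ℕ} (K : ℕ) (X : Finset (Fin P)) (hX : X.card ≤ K) :
    ((powersetCard K univ).filter (X ⊆ ·)).card = (P - X.card).choose (K - X.card) := by
  have h2 : (powersetCard (K - X.card) (univ \ X)).card = (P - X.card).choose (K - X.card) := by
    rw [card_powersetCard, card_sdiff_of_subset (subset_univ X), card_univ, Fintype.card_fin]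
  rw [← h2]
  refine card_bij' (fun S _ => S \ X) (fun S _ => S ∪ X) ?_ ?_ ?_ ?_
  · intro S hS
    simp only [mem_filter, mem_powersetCard, subset_univ, true_and] at hS ⊢
    exact ⟨sdiff_subset_sdiff (subset_univ _) le_rfl, by rw [card_sdiff_of_subset hS.2, hS.1]⟩
  · intro S hS
    simp only [mem_filter, mem_powersetCard, subset_univ, true_and] at hS ⊢
    have hd : Disjoint S X := disjoint_of_subset_left hS.1 sdiff_disjoint
    exact ⟨by rw [card_union_of_disjoint hd, hS.2]; omega, subset_union_right⟩
  · intro S hS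
    simp only [mem_filter] at hS
    exact sdiff_union_of_subset hS.2
  · intro S hS
    simp only [mem_powersetCard] at hS
    have hd : Disjoint S X := disjoint_of_subset_left hS.1 sdiff_disjoint
    rw [union_sdiff_right, sdiff_eq_self_of_disjoint hd]

lemma sum_ringWeight_superset {P K : ℕ} (h : K ≤ P) (X : Finset (Fin P)) :
    ∑ x, ringWeight P K x * (if X ⊆ x then 1 else 0) =
      (K.choose X.card : ℝ) / (P.choose X.card : ℝ) := by
  rw [sum_ringWeight_mul, sum_boole]
  have hXP : X.card ≤ P := by simpa using card_le_univ X
  have hc : (P.choose K : ℝ) ≠ 0 := by exact_mod_cast (Nat.choose_pos h).ne'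
  have hc' : (P.choose X.card : ℝ) ≠ 0 := by exact_mod_cast (Nat.choose_pos hXP).ne'
  by_cases hX : X.card ≤ K
  · rw [card_powersetCard_filter_superset K X hX, inv_mul_eq_div, div_eq_div_iff hc hc']
    -- Double counting of pairs `X ⊆ S` with `S` a `K`-set: `C(P,K) C(K,j) = C(P,j) C(P-j,K-j)`.
    have := Nat.choose_mul (n := P) hX
    have h' : (P.choose K : ℝ) * K.choose X.card
      = P.choose X.card * (P - X.card).choose (K - X.card) := by exact_mod_cast this
    linarith
  · have : (powersetCard K (univ : Finset (Fin P))).filter (X ⊆ ·) = ∅ := by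
      refine filter_eq_empty_iff.2 fun S hS hXS => hX ?_
      rw [← (mem_powersetCard.1 hS).2]; exact card_le_card hXS
    rw [this, Nat.choose_eq_zero_of_lt (by omega : K < X.card)]; simp

/-- In falling factorials each factor satisfies `(K - i) / (P - i) ≤ K / P` because `K ≤ P`.
Denominators are cleared so that `j > P` needs no separate treatment. -/
lemma choose_mul_pow_le {K P : ℕ} (h : K ≤ P) (j : ℕ) :
    K.choose j * P ^ j ≤ P.choose j * K ^ j := by
  have key : K.descFactorial j * P ^ j ≤ P.descFactorial j * K ^ j := by
    induction j with
    | zero => simp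
    | succ j ih =>
      rw [Nat.descFactorial_succ, Nat.descFactorial_succ, pow_succ, pow_succ]
      have h1 : (K - j) * P ≤ (P - j) * K := by
        rcases Nat.lt_or_ge K j with hj | hj
        · simp [Nat.sub_eq_zero_of_le hj.le]
        · obtain ⟨c, rfl⟩ := Nat.exists_eq_add_of_le hj
          obtain ⟨d, rfl⟩ := Nat.exists_eq_add_of_le h
          rw [show j + c - j = c by omega, show j + c + d - j = c + d by omega]
          nlinarith
      calc (K - j) * K.descFactorial j * (P ^ j * P)
          = (K.descFactorial j * P ^ j) * ((K - j) * P) := by ring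
        _ ≤ (P.descFactorial j * K ^ j) * ((P - j) * K) := Nat.mul_le_mul ih h1
        _ = _ := by ring
  rw [Nat.descFactorial_eq_factorial_mul_choose, Nat.descFactorial_eq_factorial_mul_choose,
    mul_assoc, mul_assoc] at key
  exact Nat.le_of_mul_le_mul_left key (Nat.factorial_pos j)

lemma sum_ringWeight_superset_le {P K : ℕ} (h : K ≤ P) (hP : 0 < P) (X : Finset (Fin P)) :
    ∑ x, ringWeight P K x * (if X ⊆ x then 1 else 0) ≤ ((K : ℝ) / P) ^ X.card := by
  rw [sum_ringWeight_superset h]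
  have hXP : X.card ≤ P := by simpa using card_le_univ X
  have hc' : (0 : ℝ) < (P.choose X.card : ℝ) := by exact_mod_cast (Nat.choose_pos hXP)
  have hP' : (0 : ℝ) < P := by exact_mod_cast hP
  rw [div_pow, div_le_div_iff₀ hc' (by positivity), mul_comm ((K : ℝ) ^ _)]
  exact_mod_cast choose_mul_pow_le h X.card

/-- Union bound: the indicator of an event that forces one of the sets of the family `T` into
the ring. -/
lemma sum_ringWeight_le_of_cover {P K : ℕ} (h : K ≤ P) (hP : 0 < P) (j : ℕ)
    (T : Finset (Finset (Fin P))) (hT : ∀ X ∈ T, X.card = j) (f : Finset (Fin P) → ℝ)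
    (hf : ∀ x, f x ≤ ∑ X ∈ T, if X ⊆ x then (1 : ℝ) else 0) :
    ∑ x, ringWeight P K x * f x ≤ T.card * ((K : ℝ) / P) ^ j := by
  calc ∑ x, ringWeight P K x * f x
      ≤ ∑ x, ringWeight P K x * ∑ X ∈ T, (if X ⊆ x then (1 : ℝ) else 0) :=
        sum_le_sum fun x _ => mul_le_mul_of_nonneg_left (hf x) (ringWeight_nonneg P K x)
    _ = ∑ X ∈ T, ∑ x, ringWeight P K x * (if X ⊆ x then (1 : ℝ) else 0) := by
        simp_rw [mul_sum]; rw [sum_comm]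
    _ ≤ ∑ X ∈ T, ((K : ℝ) / P) ^ j :=
        sum_le_sum fun X hX => by
          have := sum_ringWeight_superset_le h hP X
          rwa [hT X hX] at this
    _ = _ := by simp

lemma card_filter_superset_eq_choose {P : ℕ} (A x : Finset (Fin P)) (j : ℕ) :
    (((A ∩ x).card.choose j : ℕ) : ℝ) = ∑ X ∈ powersetCard j A, if X ⊆ x then (1 : ℝ) else 0 := by
  rw [sum_boole, ← card_powersetCard]
  congr 2
  ext X
  simp only [mem_powersetCard, mem_filter, subset_inter_iff]
  tauto

lemma sum_ringWeight_choose {P K : ℕ} (h : K ≤ P) (A : Finset (Fin P)) (j : ℕ) :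
    ∑ x, ringWeight P K x * ((A ∩ x).card.choose j : ℝ) =
      (A.card.choose j : ℝ) * ((K.choose j : ℝ) / (P.choose j : ℝ)) := by
  simp_rw [card_filter_superset_eq_choose, mul_sum]
  rw [sum_comm]
  calc _ = ∑ X ∈ powersetCard j A, (K.choose j : ℝ) / (P.choose j : ℝ) :=
        sum_congr rfl fun X hX => by
          rw [sum_ringWeight_superset h, (mem_powersetCard.1 hX).2]
    _ = _ := by simp

/-! ### Sharing at least `q` keys with one given ring -/

/-- The indicator of two key rings sharing at least `q` keys. -/
noncomputable def share {P : ℕ} (q : ℕ) (A x : Finset (Fin P)) : ℝ :=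
  if q ≤ (A ∩ x).card then 1 else 0

lemma share_nonneg {P : ℕ} (q : ℕ) (A x : Finset (Fin P)) : 0 ≤ share q A x := by
  unfold share; split_ifs <;> simp

lemma share_le_one {P : ℕ} (q : ℕ) (A x : Finset (Fin P)) : share q A x ≤ 1 := by
  unfold share; split_ifs <;> simp

/-- The probability that a uniform key ring shares at least `q` keys with `A`. -/
noncomputable def shareProb (P K q : ℕ) (A : Finset (Fin P)) : ℝ :=
  ∑ x, ringWeight P K x * share q A x

/-- A permutation of the pool carrying `A` to `B` preserves the uniform law of the other ring. -/
lemma shareProb_eq_of_card_eq {P : ℕ} (K q : ℕ) {A B : Finset (Fin P)} (h : A.card = B.card) :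
    shareProb P K q A = shareProb P K q B := by
  classical
  obtain ⟨σ, hσ⟩ : ∃ σ : Equiv.Perm (Fin P), A.map σ.toEmbedding = B := by
    have e : {x // x ∈ A} ≃ {x // x ∈ B} := Finset.equivOfCardEq h
    refine ⟨e.extendSubtype, ?_⟩
    refine eq_of_subset_of_card_le ?_ (by simp [h])
    intro y hy
    obtain ⟨x, hx, rfl⟩ := mem_map.1 hy
    exact e.extendSubtype_mem x hx
  unfold shareProb
  refine Fintype.sum_equiv (σ.finsetCongr) _ _ fun x => ?_
  have h1 : (σ.finsetCongr x).card = x.card := by simp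
  have h2 : (B ∩ σ.finsetCongr x).card = (A ∩ x).card := by
    rw [← hσ, Equiv.finsetCongr_apply, ← map_inter, card_map]
  rw [ringWeight, share, ringWeight, share, h1, h2]

/-- A Bonferroni inequality, with equality at `y = q` and `y = q + 1`. For `y = q + d` with `d ≥ 2`
the left side is nonpositive, since `q * C(y,q+1) / C(y,q) = q * d / (q + 1) ≥ 1`. -/
lemma choose_sub_le_indicator {q : ℕ} (hq : 1 ≤ q) (y : ℕ) :
    (y.choose q : ℝ) - q * y.choose (q + 1) ≤ if q ≤ y then 1 else 0 := by
  split_ifs with h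
  · obtain ⟨d, rfl⟩ := Nat.exists_eq_add_of_le h
    have h1 : (q + d).choose (q + 1) * (q + 1) = (q + d).choose q * d := by
      have := Nat.choose_succ_right_eq (q + d) q
      rwa [show q + d - q = d by omega] at this
    have h1' : ((q + d).choose (q + 1) : ℝ) * (q + 1) = (q + d).choose q * d := by
      exact_mod_cast h1
    have hq' : (1 : ℝ) ≤ q := by exact_mod_cast hq
    rcases d with _ | _ | d
    · simp
    · simp only [zero_add, Nat.choose_self, Nat.cast_one, mul_one] at h1' ⊢
      rw [Nat.choose_succ_self_right]; push_cast; linarith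
    · have hp : (0 : ℝ) ≤ (q + (d + 1 + 1)).choose q := by positivity
      have h3 : ((q + (d + 1 + 1)).choose q : ℝ) * (q + 1)
          ≤ q * (q + (d + 1 + 1)).choose (q + 1) * (q + 1) := by
        rw [mul_assoc, h1', ← mul_assoc, mul_comm (q : ℝ), mul_assoc]
        refine mul_le_mul_of_nonneg_left ?_ hp
        push_cast
        have hd : (0 : ℝ) ≤ d := by positivity
        nlinarith
      have := le_of_mul_le_mul_right h3 (by positivity)
      linarith
  · have h : y < q := by omega
    rw [Nat.choose_eq_zero_of_lt h, Nat.choose_eq_zero_of_lt (by omega : y < q + 1)]; simp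

lemma choose_mul_div_pow_le {P K : ℕ} (j : ℕ) :
    (K.choose j : ℝ) * ((K : ℝ) / P) ^ j ≤ ((K : ℝ) ^ 2 / P) ^ j := by
  have : (K.choose j : ℝ) ≤ (K : ℝ) ^ j := by exact_mod_cast Nat.choose_le_pow K j
  calc _ ≤ (K : ℝ) ^ j * ((K : ℝ) / P) ^ j := by gcongr
    _ = _ := by rw [← mul_pow]; congr 1; ring

lemma half_pow_le_choose {K q : ℕ} (h : 2 * q ≤ K) :
    ((K : ℝ) / 2) ^ q / (q.factorial : ℝ) ≤ K.choose q := by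
  have h1 : (K + 1 - q) ^ q ≤ K.descFactorial q := Nat.pow_sub_le_descFactorial K q
  have h2 : ((K : ℝ) / 2) ^ q ≤ ((K + 1 - q : ℕ) : ℝ) ^ q := by
    refine pow_le_pow_left₀ (by positivity) ?_ _
    rw [Nat.cast_sub (by omega)]
    have : (2 : ℝ) * q ≤ K := by exact_mod_cast h
    push_cast; linarith
  rw [div_le_iff₀ (by positivity)]
  refine h2.trans ?_
  have h3 : ((K + 1 - q : ℕ) : ℝ) ^ q ≤ K.descFactorial q := by exact_mod_cast h1
  rw [Nat.descFactorial_eq_factorial_mul_choose] at h3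
  push_cast at h3
  linarith

/-- A lower bound, of the right order, for the probability of sharing at least `q` keys. -/
lemma shareProb_lower {P K q : ℕ} (hq : 1 ≤ q) (h : K ≤ P) (hK : 2 * q ≤ K)
    {A : Finset (Fin P)} (hA : A.card = K) :
    ((K : ℝ) ^ 2 / P) ^ q * (1 / (4 ^ q * q.factorial) - q * ((K : ℝ) ^ 2 / P)) ≤
      shareProb P K q A := by
  have hP : 0 < P := by omega
  have hP' : (0 : ℝ) < P := by exact_mod_cast hP
  have h1 : ∑ x, ringWeight P K x *
      (((A ∩ x).card.choose q : ℝ) - q * (A ∩ x).card.choose (q + 1)) ≤ shareProb P K q A :=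
    sum_le_sum fun x _ => mul_le_mul_of_nonneg_left (choose_sub_le_indicator hq _)
      (ringWeight_nonneg P K x)
  have h2 : ∑ x, ringWeight P K x *
      (((A ∩ x).card.choose q : ℝ) - q * (A ∩ x).card.choose (q + 1)) =
      (K.choose q : ℝ) * ((K.choose q : ℝ) / (P.choose q : ℝ)) -
      q * ((K.choose (q + 1) : ℝ) * ((K.choose (q + 1) : ℝ) / (P.choose (q + 1) : ℝ))) := by
    rw [← hA, ← sum_ringWeight_choose (by omega), ← sum_ringWeight_choose (by omega), mul_sum,
      ← sum_sub_distrib]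
    exact sum_congr rfl fun x _ => by ring
  rw [h2] at h1
  refine le_trans ?_ h1
  -- The subtracted moment is one power of `K ^ 2 / P` smaller than the main term bounded below in
  -- `h4`.
  have h3 : (K.choose (q + 1) : ℝ) * ((K.choose (q + 1) : ℝ) / (P.choose (q + 1) : ℝ)) ≤
      ((K : ℝ) ^ 2 / P) ^ (q + 1) := by
    refine le_trans (mul_le_mul_of_nonneg_left ?_ (by positivity)) (choose_mul_div_pow_le (q + 1))
    rw [div_pow]
    rcases Nat.lt_or_ge P (q + 1) with hPq | hPq
    · rw [Nat.choose_eq_zero_of_lt hPq]; simp; positivity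
    · have : (0 : ℝ) < (P.choose (q + 1) : ℝ) := by exact_mod_cast Nat.choose_pos hPq
      rw [div_le_div_iff₀ this (by positivity), mul_comm ((K : ℝ) ^ _)]
      exact_mod_cast choose_mul_pow_le h (q + 1)
  have h4 : ((K : ℝ) ^ 2 / P) ^ q * (1 / (4 ^ q * q.factorial)) ≤
      (K.choose q : ℝ) * ((K.choose q : ℝ) / (P.choose q : ℝ)) := by
    have a1 := half_pow_le_choose hK
    have a2 : (P.choose q : ℝ) ≤ (P : ℝ) ^ q / q.factorial := Nat.choose_le_pow_div q P
    have a3 : (0 : ℝ) < P.choose q := by exact_mod_cast Nat.choose_pos (by omega)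
    calc ((K : ℝ) ^ 2 / P) ^ q * (1 / (4 ^ q * q.factorial))
        = (((K : ℝ) / 2) ^ q / q.factorial) * ((((K : ℝ) / 2) ^ q / q.factorial) /
          ((P : ℝ) ^ q / q.factorial)) := by
          rw [div_pow, div_pow, ← pow_mul, pow_mul', show (4 : ℝ) = 2 * 2 by norm_num, mul_pow]
          have : (q.factorial : ℝ) ≠ 0 := by positivity
          field_simp
      _ ≤ _ := by gcongr
  have hq0 : (0 : ℝ) ≤ q := by positivity
  calc _ = ((K : ℝ) ^ 2 / P) ^ q * (1 / (4 ^ q * q.factorial)) -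
        q * ((K : ℝ) ^ 2 / P) ^ (q + 1) := by ring
    _ ≤ _ := by nlinarith

/-! ### Sharing at least `q` keys with two given rings -/

/-- The probability that a uniform key ring shares at least `q` keys with both `A` and `B`. -/
noncomputable def bothProb (P K q : ℕ) (A B : Finset (Fin P)) : ℝ :=
  ∑ x, ringWeight P K x * (share q A x * share q B x)

lemma bothProb_nonneg (P K q : ℕ) (A B : Finset (Fin P)) : 0 ≤ bothProb P K q A B :=
  sum_nonneg fun x _ => mul_nonneg (ringWeight_nonneg _ _ _)
    (mul_nonneg (share_nonneg _ _ _) (share_nonneg _ _ _))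

/-- The number of `j + 1`-element subsets of `A` that contain `z`. -/
lemma card_powersetCard_filter_mem {P : ℕ} (A : Finset (Fin P)) (z : Fin P) (hz : z ∈ A) (j : ℕ) :
    ((powersetCard (j + 1) A).filter (z ∈ ·)).card = (A.card - 1).choose j := by
  rw [← card_erase_of_mem hz, ← card_powersetCard]
  refine card_bij' (fun S _ => S.erase z) (fun S _ => insert z S) ?_ ?_ ?_ ?_
  · intro S hS
    simp only [mem_filter, mem_powersetCard] at hS ⊢
    exact ⟨erase_subset_erase _ hS.1.1, by rw [card_erase_of_mem hS.2, hS.1.2]; rfl⟩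
  · intro S hS
    simp only [mem_filter, mem_powersetCard] at hS ⊢
    have hzS : z ∉ S := fun h => by simpa using hS.1 h
    exact ⟨⟨insert_subset hz (hS.1.trans (erase_subset _ _)), by
      rw [card_insert_of_notMem hzS, hS.2]⟩, mem_insert_self _ _⟩
  · intro S hS
    exact insert_erase (mem_filter.1 hS).2
  · intro S hS
    simp only [mem_powersetCard] at hS
    have hzS : z ∉ S := fun h => by simpa using hS.1 h
    exact erase_insert hzS

/-- If `x` contains a key `z` common to `A` and `B`, then some `q`-subset of `A` through `z` lies in
`x`. Otherwise the keys shared with `A` and with `B` lie in the disjoint sets `A \ B` and `B \ A`,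
which forces `2 * q` distinct keys into `x`. -/
lemma share_mul_share_le {P q : ℕ} (hq : 1 ≤ q) (A B x : Finset (Fin P)) :
    share q A x * share q B x ≤
      (∑ X ∈ ((powersetCard q (A \ B)) ×ˢ (powersetCard q (B \ A))).image (fun X => X.1 ∪ X.2),
        if X ⊆ x then (1 : ℝ) else 0) +
      ∑ z ∈ A ∩ B, ∑ X ∈ (powersetCard q A).filter (z ∈ ·), if X ⊆ x then (1 : ℝ) else 0 := by
  have n1 : (0 : ℝ) ≤ ∑ X ∈ ((powersetCard q (A \ B)) ×ˢ (powersetCard q (B \ A))).image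
      (fun X => X.1 ∪ X.2), if X ⊆ x then (1 : ℝ) else 0 :=
    sum_nonneg fun X _ => by split_ifs <;> simp
  have n3 : ∀ z, (0 : ℝ) ≤ ∑ X ∈ (powersetCard q A).filter (z ∈ ·), if X ⊆ x then (1 : ℝ) else 0 :=
    fun z => sum_nonneg fun X _ => by split_ifs <;> simp
  have n2 : (0 : ℝ) ≤ ∑ z ∈ A ∩ B, ∑ X ∈ (powersetCard q A).filter (z ∈ ·),
      if X ⊆ x then (1 : ℝ) else 0 := sum_nonneg fun z _ => n3 z
  by_cases hA : q ≤ (A ∩ x).card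
  swap
  · simp only [share, hA, if_false, zero_mul]; positivity
  by_cases hB : q ≤ (B ∩ x).card
  swap
  · simp only [share, hB, if_false, mul_zero]; positivity
  simp only [share, hA, hB, if_true, mul_one]
  by_cases hz : (A ∩ B ∩ x).Nonempty
  · obtain ⟨z, hz⟩ := hz
    simp only [mem_inter] at hz
    obtain ⟨X, hzX, hXA, hXc⟩ := exists_subsuperset_card_eq (s := {z}) (t := A ∩ x) (n := q)
      (by simp [hz]) (by simpa using hq) hA
    have hXA' := subset_inter_iff.1 hXA
    have h1 : (1 : ℝ) ≤ ∑ X ∈ (powersetCard q A).filter (z ∈ ·), if X ⊆ x then (1 : ℝ) else 0 := by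
      refine le_trans ?_ (single_le_sum (f := fun X => if X ⊆ x then (1 : ℝ) else 0) (a := X)
        (fun _ _ => by split_ifs <;> simp) ?_)
      · simp [hXA'.2]
      · simpa [mem_powersetCard, hXA'.1, hXc] using hzX
    have h2 := single_le_sum (f := fun z => ∑ X ∈ (powersetCard q A).filter (z ∈ ·),
      if X ⊆ x then (1 : ℝ) else 0) (fun z _ => n3 z) (mem_inter.2 ⟨hz.1.1, hz.1.2⟩)
    linarith
  · rw [not_nonempty_iff_eq_empty] at hz
    have e1 : A ∩ x ⊆ A \ B := fun y hy => by
      have := mem_inter.1 hy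
      refine mem_sdiff.2 ⟨this.1, fun hB => ?_⟩
      have : y ∈ A ∩ B ∩ x := by simp [this.1, hB, this.2]
      simp [hz] at this
    have e2 : B ∩ x ⊆ B \ A := fun y hy => by
      have := mem_inter.1 hy
      refine mem_sdiff.2 ⟨this.1, fun hB => ?_⟩
      have : y ∈ A ∩ B ∩ x := by simp [this.1, hB, this.2]
      simp [hz] at this
    obtain ⟨X, hX, hXc⟩ := exists_subset_card_eq hA
    obtain ⟨Y, hY, hYc⟩ := exists_subset_card_eq hB
    have h1 : (1 : ℝ) ≤ ∑ X ∈ ((powersetCard q (A \ B)) ×ˢ (powersetCard q (B \ A))).image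
        (fun X => X.1 ∪ X.2), if X ⊆ x then (1 : ℝ) else 0 := by
      refine le_trans ?_ (single_le_sum (f := fun X => if X ⊆ x then (1 : ℝ) else 0) (a := X ∪ Y)
        (fun _ _ => by split_ifs <;> simp) ?_)
      · simp [union_subset (hX.trans inter_subset_right) (hY.trans inter_subset_right)]
      · refine mem_image.2 ⟨(X, Y), ?_, rfl⟩
        simp [mem_powersetCard, hX.trans e1, hY.trans e2, hXc, hYc]
    linarith

/-- Union bound over the two families of `share_mul_share_le`: at most `K ^ (2 * q)` sets of size `2
* q`, and at most `K ^ (q - 1)` sets of size `q` for each common key. The missing power of `K` in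
the second count is the source of the factor `1 / K`. -/
lemma bothProb_le {P K q : ℕ} (hq : 1 ≤ q) (h : K ≤ P) (hK : 0 < K) {A B : Finset (Fin P)}
    (hA : A.card = K) (hB : B.card = K) :
    bothProb P K q A B ≤ ((K : ℝ) ^ 2 / P) ^ (2 * q) +
      ((A ∩ B).card / K : ℝ) * ((K : ℝ) ^ 2 / P) ^ q := by
  have hP : 0 < P := by omega
  set T := ((powersetCard q (A \ B)) ×ˢ (powersetCard q (B \ A))).image (fun X => X.1 ∪ X.2)
  have hT : ∀ X ∈ T, X.card = 2 * q := by
    intro X hX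
    obtain ⟨⟨Y, Z⟩, hYZ, rfl⟩ := mem_image.1 hX
    simp only [mem_product, mem_powersetCard] at hYZ
    rw [card_union_of_disjoint, hYZ.1.2, hYZ.2.2, two_mul]
    exact disjoint_of_subset_left hYZ.1.1 (disjoint_of_subset_right hYZ.2.1
      (disjoint_of_subset_right sdiff_subset sdiff_disjoint))
  have hTc : (T.card : ℝ) ≤ (K : ℝ) ^ (2 * q) := by
    have : T.card ≤ K ^ q * K ^ q := by
      refine card_image_le.trans ?_
      rw [card_product, card_powersetCard, card_powersetCard]
      refine Nat.mul_le_mul ((Nat.choose_le_pow _ _).trans (Nat.pow_le_pow_left ?_ _))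
        ((Nat.choose_le_pow _ _).trans (Nat.pow_le_pow_left ?_ _))
      · exact hA ▸ card_le_card sdiff_subset
      · exact hB ▸ card_le_card sdiff_subset
    rw [two_mul, pow_add]; exact_mod_cast this
  have b1 := sum_ringWeight_le_of_cover h hP (2 * q) T hT
    (fun x => ∑ X ∈ T, if X ⊆ x then (1 : ℝ) else 0) (fun _ => le_rfl)
  have b2 : ∀ z ∈ A ∩ B, ∑ x, ringWeight P K x *
      (∑ X ∈ (powersetCard q A).filter (z ∈ ·), if X ⊆ x then (1 : ℝ) else 0) ≤
      (K : ℝ) ^ (q - 1) * ((K : ℝ) / P) ^ q := by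
    intro z hz
    refine (sum_ringWeight_le_of_cover h hP q _ (fun X hX => ?_) _ (fun x => le_rfl)).trans ?_
    · exact (mem_powersetCard.1 (mem_filter.1 hX).1).2
    · refine mul_le_mul_of_nonneg_right ?_ (by positivity)
      obtain ⟨q, rfl⟩ := Nat.exists_eq_succ_of_ne_zero (by omega : q ≠ 0)
      rw [Nat.succ_eq_add_one, card_powersetCard_filter_mem A z (mem_inter.1 hz).1 q, hA]
      have : (K - 1).choose q ≤ K ^ q :=
        (Nat.choose_le_pow _ _).trans (Nat.pow_le_pow_left (by omega) _)
      exact_mod_cast this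
  calc bothProb P K q A B
      ≤ ∑ x, ringWeight P K x * ((∑ X ∈ T, if X ⊆ x then (1 : ℝ) else 0) +
        ∑ z ∈ A ∩ B, ∑ X ∈ (powersetCard q A).filter (z ∈ ·), if X ⊆ x then (1 : ℝ) else 0) :=
        sum_le_sum fun x _ => mul_le_mul_of_nonneg_left (share_mul_share_le hq A B x)
          (ringWeight_nonneg P K x)
    _ = ∑ x, ringWeight P K x * (∑ X ∈ T, if X ⊆ x then (1 : ℝ) else 0) +
        ∑ z ∈ A ∩ B, ∑ x, ringWeight P K x *
          (∑ X ∈ (powersetCard q A).filter (z ∈ ·), if X ⊆ x then (1 : ℝ) else 0) := by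
        rw [sum_comm (s := A ∩ B), ← sum_add_distrib]
        refine sum_congr rfl fun x _ => ?_
        rw [mul_add, mul_sum (s := A ∩ B)]
    _ ≤ T.card * ((K : ℝ) / P) ^ (2 * q) +
        ∑ z ∈ A ∩ B, (K : ℝ) ^ (q - 1) * ((K : ℝ) / P) ^ q := add_le_add b1 (sum_le_sum b2)
    _ ≤ (K : ℝ) ^ (2 * q) * ((K : ℝ) / P) ^ (2 * q) +
        ∑ z ∈ A ∩ B, (K : ℝ) ^ (q - 1) * ((K : ℝ) / P) ^ q := by gcongr
    _ = _ := by
        have hK' : (K : ℝ) ≠ 0 := by positivity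
        rw [sum_const, nsmul_eq_mul, ← mul_pow]
        congr 1
        · congr 1; ring
        · have : (K : ℝ) ^ (q - 1) = (K : ℝ) ^ q / K := by
            rw [eq_div_iff hK', ← pow_succ, Nat.sub_add_cancel hq]
          rw [this, div_mul_eq_mul_div, ← mul_pow, div_mul_eq_mul_div, mul_div_assoc]
          congr 2
          rw [sq, mul_div_assoc]

/-- Exponential moment of the overlap of a uniform key ring with `A`, on the event that the
overlap is nonempty. -/
lemma sum_ringWeight_pow_inter_le {P K : ℕ} (h : K ≤ P) (hK : 0 < K) {A : Finset (Fin P)}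
    (hA : A.card = K) {z : ℝ} (hz : 2 ≤ z) :
    ∑ x, ringWeight P K x * (if (A ∩ x).Nonempty then z ^ (A ∩ x).card else 0) ≤
      2 * (Real.exp (z * ((K : ℝ) ^ 2 / P)) - 1) := by
  have hP : 0 < P := by omega
  -- Subtracting 1 removes the empty overlap, and `z ≥ 2` makes the cost on nonempty overlaps a
  -- factor 2. The bound therefore tends to zero with `z * K ^ 2 / P`.
  have h1 : ∀ x, (if (A ∩ x).Nonempty then z ^ (A ∩ x).card else 0) ≤
      2 * (z ^ (A ∩ x).card - 1) := by
    intro x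
    split_ifs with hx
    · have : z ^ 1 ≤ z ^ (A ∩ x).card := pow_le_pow_right₀ (by linarith) (card_pos.2 hx)
      rw [pow_one] at this; linarith
    · rw [not_nonempty_iff_eq_empty] at hx; simp [hx]
  -- Binomial expansion of `((z - 1) + 1) ^ |A ∩ x|` over subsets, which reduces the moment to
  -- containment probabilities.
  have h2 : ∀ x, z ^ (A ∩ x).card = ∑ X ∈ A.powerset, (z - 1) ^ X.card * if X ⊆ x then 1 else 0 := by
    intro x
    have := sum_pow_mul_eq_add_pow (z - 1) 1 (A ∩ x)
    simp only [one_pow, mul_one, sub_add_cancel] at this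
    rw [← this]
    simp_rw [mul_ite, mul_one, mul_zero]
    rw [← sum_filter]
    refine sum_congr ?_ fun _ _ => rfl
    ext X
    rw [mem_powerset, mem_filter, mem_powerset, subset_inter_iff]
  have h3 : ∑ x, ringWeight P K x * z ^ (A ∩ x).card ≤ Real.exp (z * ((K : ℝ) ^ 2 / P)) := by
    calc ∑ x, ringWeight P K x * z ^ (A ∩ x).card
        = ∑ X ∈ A.powerset, (z - 1) ^ X.card *
            ∑ x, ringWeight P K x * (if X ⊆ x then 1 else 0) := by
          simp_rw [h2, mul_sum]
          rw [sum_comm]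
          exact sum_congr rfl fun X _ => sum_congr rfl fun x _ => by ring
      _ ≤ ∑ X ∈ A.powerset, (z - 1) ^ X.card * ((K : ℝ) / P) ^ X.card :=
          sum_le_sum fun X _ => mul_le_mul_of_nonneg_left (sum_ringWeight_superset_le h hP X)
            (pow_nonneg (by linarith) _)
      _ = ((z - 1) * ((K : ℝ) / P) + 1) ^ K := by
          have := sum_pow_mul_eq_add_pow ((z - 1) * ((K : ℝ) / P)) 1 A
          simp only [one_pow, mul_one, mul_pow] at this
          rw [this, hA]
      _ ≤ (Real.exp (z * ((K : ℝ) / P))) ^ K := by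
          refine pow_le_pow_left₀ ?_ ?_ _
          · have : 0 ≤ (z - 1) * ((K : ℝ) / P) := mul_nonneg (by linarith) (by positivity)
            linarith
          · refine (Real.add_one_le_exp _).trans (Real.exp_le_exp.2 ?_)
            exact mul_le_mul_of_nonneg_right (by linarith) (by positivity)
      _ = _ := by
          rw [← Real.exp_nat_mul]; congr 1; ring
  calc _ ≤ ∑ x, ringWeight P K x * (2 * (z ^ (A ∩ x).card - 1)) :=
        sum_le_sum fun x _ => mul_le_mul_of_nonneg_left (h1 x) (ringWeight_nonneg P K x)
    _ = 2 * (∑ x, ringWeight P K x * z ^ (A ∩ x).card - 1) := by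
        nth_rewrite 2 [← sum_ringWeight h]
        rw [← sum_sub_distrib, mul_sum]
        exact sum_congr rfl fun x _ => by ring
    _ ≤ _ := by linarith

/-! ### The law of the network as a finite sum -/

instance simpleGraph_measurableSingletonClass (n : ℕ) :
    MeasurableSingletonClass (SimpleGraph (Fin n)) where
  measurableSet_singleton G := by
    have h : ({G} : Set (SimpleGraph (Fin n))) =
        SimpleGraph.edgeSet ⁻¹' {G.edgeSet} := by
      ext H; simp
    rw [h]
    exact SimpleGraph.measurableEmbedding_edgeSet.measurable (measurableSet_singleton _)

lemma setOf_card_eq (P K : ℕ) : {S : Finset (Fin P) | S.card = K} =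
    (↑(powersetCard K (univ : Finset (Fin P))) : Set (Finset (Fin P))) := by
  ext S; simp [mem_powersetCard]

lemma isProbabilityMeasure_keyRingLaw {P K : ℕ} (h : K ≤ P) :
    IsProbabilityMeasure (keyRingLaw P K) := by
  unfold keyRingLaw
  rw [setOf_card_eq]
  refine isProbabilityMeasure_uniformOn (finite_toSet _) ?_
  rw [coe_nonempty, powersetCard_nonempty]
  simpa using h

lemma keyRingLaw_real_singleton {P K : ℕ} (x : Finset (Fin P)) :
    (keyRingLaw P K).real {x} = ringWeight P K x := by
  unfold keyRingLaw
  rw [setOf_card_eq, measureReal_def, ← coe_singleton, uniformOn_apply_finset]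
  unfold ringWeight
  split_ifs with hx
  · have : powersetCard K univ ∩ {x} = {x} := by
      rw [inter_eq_right]; simp [mem_powersetCard, hx]
    rw [this]; simp [card_powersetCard]
  · have : powersetCard K univ ∩ {x} = ∅ := by
      rw [inter_singleton_of_notMem]; simp [mem_powersetCard, hx]
    rw [this]; simp

lemma real_eq_sum {Ω : Type*} [Fintype Ω] [MeasurableSpace Ω] [MeasurableSingletonClass Ω]
    (μ : Measure Ω) [IsFiniteMeasure μ] (A : Set Ω) [DecidablePred (· ∈ A)] :
    μ.real A = ∑ x, if x ∈ A then μ.real {x} else 0 := by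
  rw [← sum_filter, sum_measureReal_singleton]
  congr 1; ext; simp

lemma prod_real_eq_sum {Ω Ω' : Type*} [Fintype Ω] [MeasurableSpace Ω] [MeasurableSingletonClass Ω]
    [MeasurableSpace Ω'] [Finite Ω'] [MeasurableSingletonClass Ω']
    (μ : Measure Ω) [IsFiniteMeasure μ] (ν : Measure Ω') [IsFiniteMeasure ν] (A : Set (Ω × Ω')) :
    (μ.prod ν).real A = ∑ x, μ.real {x} * ν.real (Prod.mk x ⁻¹' A) := by
  rw [measureReal_def, Measure.prod_apply (Set.toFinite A).measurableSet, lintegral_fintype,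
    ENNReal.toReal_sum (fun x _ => ENNReal.mul_ne_top (measure_ne_top _ _) (measure_ne_top _ _))]
  exact sum_congr rfl fun x _ => by rw [ENNReal.toReal_mul, mul_comm]; rfl

lemma keyShareProb_eq {P K q : ℕ} (h : K ≤ P) {A : Finset (Fin P)} (hA : A.card = K) :
    keyShareProb P K q = shareProb P K q A := by
  have := isProbabilityMeasure_keyRingLaw h
  classical
  unfold keyShareProb
  rw [prod_real_eq_sum]
  have h1 : ∀ x : Finset (Fin P), (keyRingLaw P K).real
      (Prod.mk x ⁻¹' {x | q ≤ (x.1 ∩ x.2).card}) = shareProb P K q x := by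
    intro x
    rw [real_eq_sum, shareProb]
    refine sum_congr rfl fun y _ => ?_
    rw [keyRingLaw_real_singleton]
    simp [share]
  simp_rw [h1, keyRingLaw_real_singleton]
  have h2 : ∀ x, ringWeight P K x * shareProb P K q x =
      ringWeight P K x * shareProb P K q A := by
    intro x
    by_cases hx : x.card = K
    · rw [shareProb_eq_of_card_eq K q (hx.trans hA.symm)]
    · simp [ringWeight, hx]
  simp_rw [h2]
  rw [← sum_mul, sum_ringWeight h, one_mul]

lemma isProbabilityMeasure_networkLaw {n P K : ℕ} (h : K ≤ P) (p : unitInterval) :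
    IsProbabilityMeasure (networkLaw n P K p) := by
  have := isProbabilityMeasure_keyRingLaw h
  unfold networkLaw; infer_instance

lemma networkLaw_real {n P K : ℕ} (h : K ≤ P) (p : unitInterval) (A : Set (Outcome n P)) :
    (networkLaw n P K p).real A = ∑ S : Fin n → Finset (Fin P), (∏ i, ringWeight P K (S i)) *
      (SimpleGraph.binomialRandom (Fin n) p).real {G | (S, G) ∈ A} := by
  have := isProbabilityMeasure_keyRingLaw h
  unfold networkLaw
  rw [prod_real_eq_sum]
  refine sum_congr rfl fun S _ => ?_
  congr 1
  rw [measureReal_def, Measure.pi_singleton, ENNReal.toReal_prod]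
  exact prod_congr rfl fun i _ => keyRingLaw_real_singleton (S i)

/-- The channels between `V` and its complement are independent. -/
lemma binomialRandom_real_cut {n : ℕ} (V : Finset (Fin n)) (p : unitInterval)
    (B : {i // i ∈ V} → {w // w ∉ V} → Prop → Prop) [∀ i w a, Decidable (B i w a)] :
    (SimpleGraph.binomialRandom (Fin n) p).real
      {G | ∀ (w : {w // w ∉ V}) (i : {i // i ∈ V}), B i w (G.Adj (i : Fin n) (w : Fin n))} =
      ∏ w, ∏ i, ((if B i w True then (p : ℝ) else 0) +
        (if B i w False then 1 - (p : ℝ) else 0)) := by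
  classical
  set E : Finset (Sym2 (Fin n)) :=
    (univ : Finset ({w // w ∉ V} × {i // i ∈ V})).image (fun x => s((x.2 : Fin n), (x.1 : Fin n)))
  have hinj : Set.InjOn (fun x : {w // w ∉ V} × {i // i ∈ V} => s((x.2 : Fin n), (x.1 : Fin n)))
      (univ : Finset ({w // w ∉ V} × {i // i ∈ V})) := by
    rintro ⟨⟨w, hw⟩, ⟨i, hi⟩⟩ - ⟨⟨w', hw'⟩, ⟨i', hi'⟩⟩ - h
    simp only [Sym2.eq_iff] at h
    rcases h with ⟨rfl, rfl⟩ | ⟨rfl, rfl⟩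
    · rfl
    · exact absurd hi hw'
  set t : Sym2 (Fin n) → Set Prop := fun e => {a | ∀ (w : {w // w ∉ V}) (i : {i // i ∈ V}),
    s((i : Fin n), (w : Fin n)) = e → B i w a}
  have ht : ∀ (w : {w // w ∉ V}) (i : {i // i ∈ V}), t s((i : Fin n), (w : Fin n)) = {a | B i w a} := by
    intro w i
    ext a
    refine ⟨fun h => h w i rfl, fun h w' i' hwi => ?_⟩
    have := @hinj (w', i') (by simp) (w, i) (by simp) hwi
    simp only [Prod.mk.injEq] at this
    rw [this.1, this.2]; exact h
  rw [measureReal_def, SimpleGraph.binomialRandom_eq_map, Measure.map_apply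
    SimpleGraph.measurable_fromEdgeSet (Set.toFinite _).measurableSet, setBernoulli_apply']
  -- The event is a cylinder over the finitely many cut edges `E`, so the product measure evaluates
  -- it factor by factor.
  have hset : (fun p : Sym2 (Fin n) → Prop => {i | p i}) ⁻¹' (SimpleGraph.fromEdgeSet ⁻¹'
      {G : SimpleGraph (Fin n) | ∀ (w : {w // w ∉ V}) (i : {i // i ∈ V}), B i w (G.Adj i w)}) =
      (E : Set (Sym2 (Fin n))).pi t := by
    ext f
    have hne : ∀ (w : {w // w ∉ V}) (i : {i // i ∈ V}), (i : Fin n) ≠ w :=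
      fun w i h => w.2 (h ▸ i.2)
    simp only [Set.mem_preimage, Set.mem_ofPred_eq, SimpleGraph.fromEdgeSet_adj, Set.mem_pi,
      mem_coe]
    constructor
    · intro h e he
      obtain ⟨⟨w, i⟩, -, rfl⟩ := mem_image.1 he
      rw [ht]
      have := h w i
      simp only [hne w i, ne_eq, not_false_eq_true, and_true] at this
      exact this
    · intro h w i
      have := h s((i : Fin n), (w : Fin n)) (mem_image.2 ⟨(w, i), mem_univ _, rfl⟩)
      rw [ht] at this
      simp only [hne w i, ne_eq, not_false_eq_true, and_true]
      exact this
  have hprob : ∀ e : Sym2 (Fin n), IsProbabilityMeasure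
      ((unitInterval.toNNReal p • Measure.dirac (e ∈ (Sym2.diagSet : Set (Sym2 (Fin n)))ᶜ) +
      unitInterval.toNNReal (unitInterval.symm p) • Measure.dirac False : Measure Prop)) := by
    intro e; infer_instance
  rw [hset, Measure.infinitePi_pi _ (fun _ _ => .of_discrete), ENNReal.toReal_prod,
    prod_image hinj, Fintype.prod_prod_type]
  refine prod_congr rfl fun w _ => prod_congr rfl fun i _ => ?_
  rw [ht]
  have hd : s((i : Fin n), (w : Fin n)) ∈ (Sym2.diagSet : Set (Sym2 (Fin n)))ᶜ := by
    rw [Set.mem_compl_iff, Sym2.mem_diagSet, Sym2.mk_isDiag_iff]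
    exact fun h => w.2 (h ▸ i.2)
  simp only [hd, Measure.coe_add, Measure.coe_nnreal_smul_apply, Pi.add_apply,
    Measure.dirac_apply, Set.indicator_apply, Set.mem_ofPred_eq, Pi.one_apply]
  split_ifs <;> simp [ENNReal.toReal_add]

/-! ### The joint law of the degrees of a fixed set of nodes -/

/-- The conditional probability, given the key ring `x` of a node and the key rings `a` of a
family of other nodes, that the neighbours of the node within the family are those in `τ`. -/
noncomputable def typeWeight {ι : Type*} [Fintype ι] [DecidableEq ι] {P : ℕ} (q : ℕ) (p : ℝ)
    (a : ι → Finset (Fin P)) (x : Finset (Fin P)) (τ : Finset ι) : ℝ :=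
  ∏ i, if i ∈ τ then p * share q (a i) x else 1 - p * share q (a i) x

/-- The conditional probability, given the key rings `a` of a family of nodes, that the
neighbours of a further node within the family are those in `τ`. -/
noncomputable def typeProb {ι : Type*} [Fintype ι] [DecidableEq ι] (P K q : ℕ) (p : ℝ)
    (a : ι → Finset (Fin P)) (τ : Finset ι) : ℝ :=
  ∑ x, ringWeight P K x * typeWeight q p a x τ

open Classical in
/-- The neighbours in `V` of each node outside `V`. -/
noncomputable def cutType {n : ℕ} (V : Finset (Fin n)) (H : SimpleGraph (Fin n)) :
    {w // w ∉ V} → Finset {i // i ∈ V} :=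
  fun w => univ.filter fun i => H.Adj (i : Fin n) (w : Fin n)

lemma binomialRandom_real_cutType {n P : ℕ} (V : Finset (Fin n)) (q : ℕ) (p : unitInterval)
    (S : Fin n → Finset (Fin P)) (T : Finset ({w // w ∉ V} → Finset {i // i ∈ V})) :
    (SimpleGraph.binomialRandom (Fin n) p).real {G | cutType V (networkGraph q (S, G)) ∈ T} =
      ∑ τ ∈ T, ∏ w : {w // w ∉ V},
        typeWeight q p (fun i : {i // i ∈ V} => S i) (S w) (τ w) := by
  classical
  have h1 : {G | cutType V (networkGraph q (S, G)) ∈ T} =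
      ⋃ τ ∈ T, {G | cutType V (networkGraph q (S, G)) = τ} := by
    ext G; simp
  rw [h1, measureReal_biUnion_finset]
  · refine sum_congr rfl fun τ _ => ?_
    have h2 : {G | cutType V (networkGraph q (S, G)) = τ} =
        {G | ∀ (w : {w // w ∉ V}) (i : {i // i ∈ V}),
          ((q ≤ (S i ∩ S w).card ∧ G.Adj (i : Fin n) (w : Fin n)) ↔ i ∈ τ w)} := by
      ext G
      simp only [Set.mem_ofPred_eq, funext_iff, Finset.ext_iff, cutType, mem_filter, mem_univ,
        true_and, networkGraph, keyGraph, SimpleGraph.inf_adj]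
      refine forall_congr' fun w => forall_congr' fun i => ?_
      have hne : (i : Fin n) ≠ w := fun h => w.2 (h ▸ i.2)
      simp [hne]
    rw [h2, binomialRandom_real_cut V p
      (fun i w a => ((q ≤ (S i ∩ S w).card ∧ a) ↔ i ∈ τ w))]
    refine prod_congr rfl fun w _ => prod_congr rfl fun i _ => ?_
    unfold share
    by_cases hi : i ∈ τ w <;> by_cases hs : q ≤ (S i ∩ S w).card <;> simp [hi, hs]
  · intro τ _ τ' _ hne
    refine Set.disjoint_left.2 fun G hG hG' => hne ?_
    simp only [Set.mem_ofPred_eq] at hG hG'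
    rw [← hG, ← hG']
  · exact fun τ _ => (Set.toFinite _).measurableSet

/-- Summing out the coordinates outside `V`, on which the summand depends as a product. -/
lemma sum_prod_cut {n : ℕ} {X : Type*} [Fintype X] (V : Finset (Fin n)) (c : X → ℝ)
    (g : {w // w ∉ V} → ({i // i ∈ V} → X) → X → ℝ) (Φ : ({i // i ∈ V} → X) → ℝ) :
    ∑ S : Fin n → X, (∏ i, c (S i)) * (Φ (fun i => S i) * ∏ w : {w // w ∉ V},
        g w (fun i => S i) (S w)) =
      ∑ a : {i // i ∈ V} → X, (∏ i, c (a i)) * (Φ a * ∏ w : {w // w ∉ V}, ∑ x, c x * g w a x) := by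
  classical
  rw [Fintype.sum_equiv (Equiv.piEquivPiSubtypeProd (fun i => i ∈ V) (fun _ => X)) _
    (fun y => ((∏ i, c (y.1 i)) * ∏ w, c (y.2 w)) * (Φ y.1 * ∏ w, g w y.1 (y.2 w)))]
  · rw [Fintype.sum_prod_type]
    refine sum_congr rfl fun a _ => ?_
    rw [prod_univ_sum, Fintype.piFinset_univ, mul_sum, mul_sum]
    refine sum_congr rfl fun y _ => ?_
    rw [prod_mul_distrib]; ring
  · intro S
    simp only [Equiv.piEquivPiSubtypeProd_apply]
    congr 1
    rw [← Fintype.prod_subtype_mul_prod_subtype (fun i => i ∈ V) (fun i => c (S i))]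
    congr 1
    exact prod_congr (by ext; simp) fun _ _ => rfl

/-- With the rings of `V` fixed, each outer node has its own ring and its own channels to `V`, so
the outer rings can be summed out one node at a time. Letting `F` depend on the rings of `V` allows
disjoint and overlapping families to be treated differently. -/
lemma networkLaw_real_cutType {n P K : ℕ} (h : K ≤ P) (V : Finset (Fin n)) (q : ℕ)
    (p : unitInterval) (F : ({i // i ∈ V} → Finset (Fin P)) →
      Finset ({w // w ∉ V} → Finset {i // i ∈ V})) :
    (networkLaw n P K p).real
        {ω | cutType V (networkGraph q ω) ∈ F (fun i => ω.1 i)} =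
      ∑ a : {i // i ∈ V} → Finset (Fin P), (∏ i, ringWeight P K (a i)) *
        ∑ τ ∈ F a, ∏ w, typeProb P K q p a (τ w) := by
  classical
  rw [networkLaw_real h]
  have h1 : ∀ S : Fin n → Finset (Fin P), (∏ i, ringWeight P K (S i)) *
      (SimpleGraph.binomialRandom (Fin n) p).real
        {G | (S, G) ∈ {ω : Outcome n P | cutType V (networkGraph q ω) ∈ F (fun i => ω.1 i)}} =
      ∑ τ, (∏ i, ringWeight P K (S i)) * ((if τ ∈ F (fun i => S i) then 1 else 0) *
        ∏ w : {w // w ∉ V}, typeWeight q p (fun i : {i // i ∈ V} => S i) (S w) (τ w)) := by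
    intro S
    have := binomialRandom_real_cutType V q p S (F (fun i => S i))
    simp only [Set.mem_ofPred_eq]
    rw [this, mul_sum, ← sum_filter_add_sum_filter_not univ (· ∈ F (fun i => S i))]
    rw [sum_eq_zero (s := univ.filter (¬ · ∈ F (fun i => S i))), add_zero, filter_mem_eq_inter,
      univ_inter]
    · exact sum_congr rfl fun τ hτ => by simp [hτ]
    · intro τ hτ; simp [(mem_filter.1 hτ).2]
  simp_rw [h1]
  rw [sum_comm]
  have h2 : ∀ τ : {w // w ∉ V} → Finset {i // i ∈ V}, _ := fun τ =>
    sum_prod_cut V (ringWeight P K) (fun w a x => typeWeight q p a x (τ w))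
      (fun a => if τ ∈ F a then 1 else 0)
  simp_rw [h2]
  rw [sum_comm]
  refine sum_congr rfl fun a _ => ?_
  rw [← mul_sum]
  congr 1
  simp_rw [ite_mul, one_mul, zero_mul]
  rw [← sum_filter, filter_mem_eq_inter, univ_inter]
  rfl

open Classical in
/-- The degree of a node in the network graph. -/
noncomputable def deg {n P : ℕ} (q : ℕ) (ω : Outcome n P) (v : Fin n) : ℕ :=
  (univ.filter fun w => (networkGraph q ω).Adj v w).card

open Classical in
lemma deg_eq_add {n P : ℕ} (V : Finset (Fin n)) (q : ℕ) (ω : Outcome n P) (i : {i // i ∈ V}) :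
    deg q ω i = (univ.filter fun w => i ∈ cutType V (networkGraph q ω) w).card +
      (univ.filter fun w => (networkGraph q ω).Adj i w ∧ w ∈ V).card := by
  have h1 : (univ.filter fun w => i ∈ cutType V (networkGraph q ω) w).card =
      (univ.filter fun w => (networkGraph q ω).Adj i w ∧ w ∉ V).card := by
    refine card_bij (fun w _ => (w : Fin n)) ?_ ?_ ?_
    · intro w hw
      simp only [cutType, mem_filter, mem_univ, true_and] at hw ⊢
      exact ⟨hw, w.2⟩
    · intro w _ w' _ h
      exact Subtype.ext h
    · intro w hw
      simp only [mem_filter, mem_univ, true_and] at hw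
      exact ⟨⟨w, hw.2⟩, by simpa [cutType] using hw.1, rfl⟩
  rw [h1, deg, add_comm, ← filter_filter, ← filter_filter, card_filter_add_card_filter_not]

/-- Families of neighbourhoods in which every `i` occurs exactly `h` times. -/
def exactTypes (ι κ : Type*) [Fintype ι] [DecidableEq ι] [Fintype κ] [DecidableEq κ] (h : ℕ) :
    Finset (κ → Finset ι) :=
  univ.filter fun τ => ∀ i, (univ.filter fun w => i ∈ τ w).card = h

/-- Families of neighbourhoods in which every `i` occurs at most `h` times. -/
def atMostTypes (ι κ : Type*) [Fintype ι] [DecidableEq ι] [Fintype κ] [DecidableEq κ] (h : ℕ) :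
    Finset (κ → Finset ι) :=
  univ.filter fun τ => ∀ i, (univ.filter fun w => i ∈ τ w).card ≤ h

/-- Pairwise disjointness of a family of key rings. -/
def Spread {ι : Type*} {P : ℕ} (a : ι → Finset (Fin P)) : Prop :=
  ∀ i j, i ≠ j → Disjoint (a i) (a j)

/-- Disjoint rings share no key and `q ≥ 1`, so `V` spans no edge and degrees are read off the cut.
-/
lemma Spread.deg_eq {n P q : ℕ} (hq : 1 ≤ q) {V : Finset (Fin n)} {ω : Outcome n P}
    (hω : Spread fun i : {i // i ∈ V} => ω.1 i) (i : {i // i ∈ V}) :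
    deg q ω i = (univ.filter fun w => i ∈ cutType V (networkGraph q ω) w).card := by
  classical
  rw [deg_eq_add V, add_eq_left, card_eq_zero, filter_eq_empty_iff]
  rintro w - ⟨hadj, hw⟩
  have hd := hω i ⟨w, hw⟩ (fun h => hadj.ne (congrArg Subtype.val h))
  have h2 : q ≤ (ω.1 i ∩ ω.1 w).card := hadj.1.2
  rw [disjoint_iff_inter_eq_empty.1 hd] at h2
  simp at h2
  omega

open Classical in
-- When rings overlap, edges inside `V` are unknown; they can only add to the degree, so the cut
-- supplies at most `h` neighbours.
lemma networkLaw_deg_le {n P K q : ℕ} (hq : 1 ≤ q) (hKP : K ≤ P) (p : unitInterval)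
    (V : Finset (Fin n)) (h : ℕ) :
    (networkLaw n P K p).real {ω | ∀ i ∈ V, deg q ω i = h} ≤
      ∑ a : {i // i ∈ V} → Finset (Fin P), (∏ i, ringWeight P K (a i)) *
        ∑ τ ∈ (if Spread a then exactTypes {i // i ∈ V} {w // w ∉ V} h
          else atMostTypes {i // i ∈ V} {w // w ∉ V} h), ∏ w, typeProb P K q p a (τ w) := by
  have := isProbabilityMeasure_networkLaw (n := n) hKP p
  rw [← networkLaw_real_cutType hKP V q p (fun a => if Spread a then
    exactTypes {i // i ∈ V} {w // w ∉ V} h else atMostTypes {i // i ∈ V} {w // w ∉ V} h)]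
  refine measureReal_mono fun ω hω => ?_
  simp only [Set.mem_ofPred_eq] at hω ⊢
  split_ifs with hs
  · simp only [exactTypes, mem_filter, mem_univ, true_and]
    exact fun i => by rw [← hω i i.2, hs.deg_eq hq]
  · simp only [atMostTypes, mem_filter, mem_univ, true_and]
    exact fun i => by rw [← hω i i.2, deg_eq_add V]; exact Nat.le_add_right _ _

open Classical in
lemma le_networkLaw_deg {n P K q : ℕ} (hq : 1 ≤ q) (hKP : K ≤ P) (p : unitInterval)
    (V : Finset (Fin n)) (h : ℕ) :
    ∑ a : {i // i ∈ V} → Finset (Fin P), (∏ i, ringWeight P K (a i)) *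
        ∑ τ ∈ (if Spread a then exactTypes {i // i ∈ V} {w // w ∉ V} h else ∅),
          ∏ w, typeProb P K q p a (τ w) ≤
      (networkLaw n P K p).real {ω | ∀ i ∈ V, deg q ω i = h} := by
  have := isProbabilityMeasure_networkLaw (n := n) hKP p
  rw [← networkLaw_real_cutType hKP V q p (fun a => if Spread a then
    exactTypes {i // i ∈ V} {w // w ∉ V} h else ∅)]
  refine measureReal_mono fun ω hω => ?_
  simp only [Set.mem_ofPred_eq] at hω ⊢
  split_ifs at hω with hs
  · simp only [exactTypes, mem_filter, mem_univ, true_and] at hω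
    exact fun i hi => by rw [← hω ⟨i, hi⟩, ← hs.deg_eq hq]
  · simp at hω

/-! ### Bounds for the probabilities of the neighbourhoods of an outer node -/

section Bonferroni

variable {ι : Type*} [DecidableEq ι]

lemma one_sub_sum_le_prod_one_sub (s : Finset ι) (x : ι → ℝ) (h0 : ∀ i, 0 ≤ x i)
    (h1 : ∀ i, x i ≤ 1) : 1 - ∑ i ∈ s, x i ≤ ∏ i ∈ s, (1 - x i) := by
  induction s using Finset.induction_on with
  | empty => simp
  | insert i s hi ih =>
    rw [sum_insert hi, prod_insert hi]
    have := mul_le_mul_of_nonneg_left ih (sub_nonneg.2 (h1 i))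
    have h2 : 0 ≤ x i * ∑ j ∈ s, x j := mul_nonneg (h0 i) (sum_nonneg fun j _ => h0 j)
    linarith

/-- The last bracket is the sum of `x i * x j` over ordered pairs of distinct indices, twice the
sharp Bonferroni term; it is the form that averages to `pairSum`. -/
lemma prod_one_sub_le (s : Finset ι) (x : ι → ℝ) (h0 : ∀ i, 0 ≤ x i) (h1 : ∀ i, x i ≤ 1) :
    ∏ i ∈ s, (1 - x i) ≤ 1 - ∑ i ∈ s, x i + ((∑ i ∈ s, x i) ^ 2 - ∑ i ∈ s, x i ^ 2) := by
  have hD : ∀ s : Finset ι, 0 ≤ (∑ i ∈ s, x i) ^ 2 - ∑ i ∈ s, x i ^ 2 := fun s =>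
    sub_nonneg.2 (sum_sq_le_sq_sum_of_nonneg fun i _ => h0 i)
  induction s using Finset.induction_on with
  | empty => simp
  | insert i s hi ih =>
    rw [sum_insert hi, prod_insert hi, sum_insert hi]
    have := mul_le_mul_of_nonneg_left ih (sub_nonneg.2 (h1 i))
    have h2 : 0 ≤ x i * ∑ j ∈ s, x j := mul_nonneg (h0 i) (sum_nonneg fun j _ => h0 j)
    have h3 := mul_nonneg (h0 i) (hD s)
    nlinarith

lemma sq_sum_sub_sum_sq [Fintype ι] (x : ι → ℝ) :
    (∑ i, x i) ^ 2 - ∑ i, x i ^ 2 = ∑ i, ∑ j, if i = j then 0 else x i * x j := by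
  rw [sq, sum_mul_sum, ← sum_sub_distrib]
  refine sum_congr rfl fun i _ => ?_
  rw [sub_eq_iff_eq_add]
  have : x i ^ 2 = ∑ j, if i = j then x i * x j else 0 := by simp [sq]
  rw [this, ← sum_add_distrib]
  exact sum_congr rfl fun j _ => by split_ifs <;> simp

end Bonferroni

section TypeProb

variable {ι : Type*} [Fintype ι] [DecidableEq ι] {P K q : ℕ} {p : ℝ} {a : ι → Finset (Fin P)}

/-- The sum, over ordered pairs of distinct members of a family, of the probability that a
further node is adjacent to both. -/
noncomputable def pairSum (P K q : ℕ) (p : ℝ) (a : ι → Finset (Fin P)) : ℝ :=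
  ∑ i, ∑ j, if i = j then 0 else p ^ 2 * bothProb P K q (a i) (a j)

lemma pairSum_nonneg : 0 ≤ pairSum P K q p a :=
  sum_nonneg fun i _ => sum_nonneg fun j _ => by
    split_ifs
    · exact le_rfl
    · exact mul_nonneg (sq_nonneg _) (bothProb_nonneg _ _ _ _ _)

lemma mul_share_nonneg (hp : 0 ≤ p) (A x : Finset (Fin P)) : 0 ≤ p * share q A x :=
  mul_nonneg hp (share_nonneg _ _ _)

lemma mul_share_le_one (hp1 : p ≤ 1) (A x : Finset (Fin P)) :
    p * share q A x ≤ 1 := mul_le_one₀ hp1 (share_nonneg _ _ _) (share_le_one _ _ _)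

lemma pairSum_eq : pairSum P K q p a = ∑ x, ringWeight P K x *
    ∑ i, ∑ j, if i = j then 0 else (p * share q (a i) x) * (p * share q (a j) x) := by
  symm
  calc _ = ∑ i, ∑ x, ringWeight P K x *
        ∑ j, if i = j then 0 else (p * share q (a i) x) * (p * share q (a j) x) := by
        rw [sum_comm]; exact sum_congr rfl fun x _ => mul_sum _ _ _
    _ = ∑ i, ∑ j, ∑ x, ringWeight P K x *
        if i = j then 0 else (p * share q (a i) x) * (p * share q (a j) x) := by
        refine sum_congr rfl fun i _ => ?_
        rw [sum_comm]; exact sum_congr rfl fun x _ => mul_sum _ _ _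
    _ = _ := by
        refine sum_congr rfl fun i _ => sum_congr rfl fun j _ => ?_
        split_ifs
        · simp
        · rw [bothProb, mul_sum]; exact sum_congr rfl fun x _ => by ring

lemma sum_ringWeight_mul_share (A : Finset (Fin P)) :
    ∑ x, ringWeight P K x * (p * share q A x) = p * shareProb P K q A := by
  unfold shareProb; rw [mul_sum]; exact sum_congr rfl fun x _ => by ring

lemma typeWeight_nonneg (hp : 0 ≤ p) (hp1 : p ≤ 1) (x : Finset (Fin P)) (τ : Finset ι) :
    0 ≤ typeWeight q p a x τ :=
  prod_nonneg fun i _ => by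
    split_ifs
    · exact mul_share_nonneg hp _ _
    · exact sub_nonneg.2 (mul_share_le_one hp1 _ _)

lemma typeProb_nonneg (hp : 0 ≤ p) (hp1 : p ≤ 1) (τ : Finset ι) : 0 ≤ typeProb P K q p a τ :=
  sum_nonneg fun x _ => mul_nonneg (ringWeight_nonneg _ _ _) (typeWeight_nonneg hp hp1 x τ)

lemma typeProb_le (hp : 0 ≤ p) (hp1 : p ≤ 1) {τ : Finset ι} {i : ι} (hi : i ∈ τ) :
    typeProb P K q p a τ ≤ p * shareProb P K q (a i) := by
  rw [← sum_ringWeight_mul_share]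
  refine sum_le_sum fun x _ => mul_le_mul_of_nonneg_left ?_ (ringWeight_nonneg _ _ _)
  unfold typeWeight
  rw [← mul_prod_erase univ _ (mem_univ i), if_pos hi]
  refine mul_le_of_le_one_right (mul_share_nonneg hp _ _) (prod_le_one (fun j _ => ?_) fun j _ => ?_)
  · split_ifs
    · exact mul_share_nonneg hp _ _
    · exact sub_nonneg.2 (mul_share_le_one hp1 _ _)
  · split_ifs
    · exact mul_share_le_one hp1 _ _
    · linarith [mul_share_nonneg (q := q) hp (a j) x]

lemma typeProb_empty_le (h : K ≤ P) (hp : 0 ≤ p) (hp1 : p ≤ 1) {t : ℝ}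
    (ht : ∀ i, p * shareProb P K q (a i) = t) :
    typeProb P K q p a ∅ ≤ Real.exp (-(Fintype.card ι * t) + pairSum P K q p a) := by
  refine le_trans ?_ (Real.add_one_le_exp _)
  calc typeProb P K q p a ∅
      ≤ ∑ x, ringWeight P K x * (1 - ∑ i, p * share q (a i) x +
        ∑ i, ∑ j, if i = j then 0 else (p * share q (a i) x) * (p * share q (a j) x)) := by
        refine sum_le_sum fun x _ => mul_le_mul_of_nonneg_left ?_ (ringWeight_nonneg _ _ _)
        rw [← sq_sum_sub_sum_sq]
        refine le_trans (le_of_eq ?_) (prod_one_sub_le univ _ (fun i => mul_share_nonneg hp _ _)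
          (fun i => mul_share_le_one hp1 _ _))
        exact prod_congr rfl fun i _ => by simp
    _ = 1 - ∑ i, p * shareProb P K q (a i) + pairSum P K q p a := by
        simp_rw [mul_add, mul_sub, sum_add_distrib, sum_sub_distrib, mul_one, sum_ringWeight h]
        rw [pairSum_eq]
        congr 2
        simp_rw [mul_sum]
        rw [sum_comm]
        exact sum_congr rfl fun i _ => sum_ringWeight_mul_share _
    _ = _ := by simp only [ht, sum_const, card_univ, nsmul_eq_mul]; ring

lemma le_typeProb_empty (h : K ≤ P) (hp : 0 ≤ p) (hp1 : p ≤ 1) {t : ℝ}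
    (ht : ∀ i, p * shareProb P K q (a i) = t) :
    1 - Fintype.card ι * t ≤ typeProb P K q p a ∅ := by
  calc 1 - Fintype.card ι * t = 1 - ∑ i, p * shareProb P K q (a i) := by
        simp only [ht, sum_const, card_univ, nsmul_eq_mul]
    _ = ∑ x, ringWeight P K x * (1 - ∑ i, p * share q (a i) x) := by
        simp_rw [mul_sub, sum_sub_distrib, mul_one, sum_ringWeight h]
        congr 1
        simp_rw [mul_sum]
        rw [sum_comm]
        exact sum_congr rfl fun i _ => (sum_ringWeight_mul_share _).symm
    _ ≤ typeProb P K q p a ∅ := by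
        refine sum_le_sum fun x _ => mul_le_mul_of_nonneg_left ?_ (ringWeight_nonneg _ _ _)
        refine (one_sub_sum_le_prod_one_sub univ _ (fun i => mul_share_nonneg hp _ _)
          (fun i => mul_share_le_one hp1 _ _)).trans (le_of_eq ?_)
        exact prod_congr rfl fun i _ => by simp

/-- Being adjacent to `i` alone fails only through a second neighbour `j`; the pairs `(i, j)` are
among those summed in `pairSum`. -/
lemma le_typeProb_singleton (hp : 0 ≤ p) (hp1 : p ≤ 1) (i : ι) :
    p * shareProb P K q (a i) - pairSum P K q p a ≤ typeProb P K q p a {i} := by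
  rw [← sum_ringWeight_mul_share, pairSum_eq, ← sum_sub_distrib]
  refine sum_le_sum fun x _ => ?_
  rw [← mul_sub]
  refine mul_le_mul_of_nonneg_left ?_ (ringWeight_nonneg _ _ _)
  have h0 : ∀ i, 0 ≤ p * share q (a i) x := fun i => mul_share_nonneg hp _ _
  have hw : typeWeight q p a x {i} =
      p * share q (a i) x * ∏ j ∈ univ.erase i, (1 - p * share q (a j) x) := by
    unfold typeWeight
    rw [← mul_prod_erase univ _ (mem_univ i), if_pos (mem_singleton_self i)]
    congr 1
    exact prod_congr rfl fun j hj => by rw [if_neg (by simpa using ne_of_mem_erase hj)]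
  rw [hw]
  have h2 := mul_le_mul_of_nonneg_left (one_sub_sum_le_prod_one_sub (univ.erase i) _ h0
    (fun j => mul_share_le_one hp1 (a j) x)) (h0 i)
  have h3 : p * share q (a i) x * ∑ j ∈ univ.erase i, p * share q (a j) x ≤
      ∑ i, ∑ j, if i = j then 0 else (p * share q (a i) x) * (p * share q (a j) x) := by
    refine le_trans (le_of_eq ?_) (single_le_sum (f := fun i => ∑ j, if i = j then 0 else
      (p * share q (a i) x) * (p * share q (a j) x)) (fun i _ => sum_nonneg fun j _ => ?_)
      (mem_univ i))
    · rw [mul_sum, ← add_sum_erase univ _ (mem_univ i), if_pos rfl, zero_add]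
      exact sum_congr rfl fun j hj => by rw [if_neg (ne_of_mem_erase hj).symm]
    · split_ifs
      · exact le_rfl
      · exact mul_nonneg (h0 i) (h0 j)
  rw [mul_sub, mul_one] at h2
  linarith

end TypeProb

/-! ### Counting families of neighbourhoods -/

section Counting

variable {ι κ : Type*} [Fintype ι] [DecidableEq ι] [Fintype κ] [DecidableEq κ]

/-- The number of outer nodes with a neighbour in the family. -/
def support (τ : κ → Finset ι) : ℕ := (univ.filter fun w => τ w ≠ ∅).card

/-- Choose the `j` outer nodes in the support, then any subset of the family for each of them. -/
lemma card_support_eq_le (j : ℕ) :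
    (univ.filter fun τ : κ → Finset ι => support τ = j).card ≤
      (Fintype.card κ * 2 ^ Fintype.card ι) ^ j := by
  have h1 : (univ.filter fun τ : κ → Finset ι => support τ = j) ⊆
      (powersetCard j (univ : Finset κ)).biUnion fun s =>
        Fintype.piFinset fun w => if w ∈ s then (univ : Finset (Finset ι)) else {∅} := by
    intro τ hτ
    rw [mem_biUnion]
    refine ⟨univ.filter fun w => τ w ≠ ∅, ?_, ?_⟩
    · exact mem_powersetCard.2 ⟨subset_univ _, (mem_filter.1 hτ).2⟩
    · rw [Fintype.mem_piFinset]
      intro w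
      by_cases h : τ w = ∅ <;> simp [h]
  refine (card_le_card h1).trans (card_biUnion_le.trans ?_)
  calc ∑ s ∈ powersetCard j (univ : Finset κ), _
      = ∑ s ∈ powersetCard j (univ : Finset κ), (2 ^ Fintype.card ι) ^ j := by
        refine sum_congr rfl fun s hs => ?_
        rw [Fintype.card_piFinset]
        have : ∀ w, (if w ∈ s then (univ : Finset (Finset ι)) else {∅}).card =
            if w ∈ s then 2 ^ Fintype.card ι else 1 := by
          intro w; split_ifs <;> simp
        simp_rw [this]
        rw [prod_ite_mem, univ_inter, prod_const, (mem_powersetCard.1 hs).2]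
    _ ≤ _ := by
        rw [sum_const, card_powersetCard, smul_eq_mul, mul_pow, card_univ]
        exact Nat.mul_le_mul_right _ (Nat.choose_le_pow _ _)

/-- Transposing the incidence relation, every `i` independently chooses an `h`-set of outer nodes.
-/
lemma card_exactTypes (h : ℕ) :
    (exactTypes ι κ h).card = (Fintype.card κ).choose h ^ Fintype.card ι := by
  have : (Fintype.piFinset fun _ : ι => powersetCard h (univ : Finset κ)).card =
      (Fintype.card κ).choose h ^ Fintype.card ι := by
    rw [Fintype.card_piFinset]; simp [card_powersetCard]
  rw [← this]
  refine card_bij' (fun τ _ i => univ.filter fun w => i ∈ τ w)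
    (fun N _ w => univ.filter fun i => w ∈ N i) ?_ ?_ ?_ ?_
  · intro τ hτ
    rw [Fintype.mem_piFinset]
    exact fun i => mem_powersetCard.2 ⟨subset_univ _, (mem_filter.1 hτ).2 i⟩
  · intro N hN
    rw [Fintype.mem_piFinset] at hN
    simp only [exactTypes, mem_filter, mem_univ, true_and]
    intro i
    rw [filter_univ_mem]
    exact (mem_powersetCard.1 (hN i)).2
  · intro τ _; ext; simp
  · intro N _; ext; simp

set_option linter.unusedSectionVars false in
lemma sum_card_eq (τ : κ → Finset ι) :
    ∑ w, (τ w).card = ∑ i, (univ.filter fun w => i ∈ τ w).card := by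
  simp_rw [card_filter]
  rw [sum_comm]
  exact sum_congr rfl fun w _ => by simp

set_option linter.unusedSectionVars false in
lemma support_le_sum_card (τ : κ → Finset ι) : support τ ≤ ∑ w, (τ w).card := by
  rw [support, card_filter]
  refine sum_le_sum fun w _ => ?_
  split_ifs with h
  · exact card_pos.2 (nonempty_iff_ne_empty.2 h)
  · exact Nat.zero_le _

lemma support_le_of_mem_atMostTypes {h : ℕ} {τ : κ → Finset ι} (hτ : τ ∈ atMostTypes ι κ h) :
    support τ ≤ Fintype.card ι * h := by
  refine (support_le_sum_card τ).trans ?_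
  rw [sum_card_eq]
  refine (sum_le_card_nsmul _ _ h fun i _ => (mem_filter.1 hτ).2 i).trans ?_
  simp

lemma exactTypes_subset_atMostTypes (h : ℕ) : exactTypes ι κ h ⊆ atMostTypes ι κ h := by
  intro τ hτ
  simp only [exactTypes, atMostTypes, mem_filter, mem_univ, true_and] at hτ ⊢
  exact fun i => (hτ i).le

/-- There are exactly `|ι| * h` incidences, and each node of the support uses at least one; full
support leaves no room for a second. -/
lemma card_le_one_of_support_eq {h : ℕ} {τ : κ → Finset ι} (hτ : τ ∈ exactTypes ι κ h)
    (hs : support τ = Fintype.card ι * h) (w : κ) : (τ w).card ≤ 1 := by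
  have h1 : ∑ w, (τ w).card = Fintype.card ι * h := by
    rw [sum_card_eq]
    simp only [exactTypes, mem_filter, mem_univ, true_and] at hτ
    simp [hτ]
  rw [support, card_filter, ← h1] at hs
  have h2 := (sum_eq_sum_iff_of_le (fun w _ => ?_)).1 hs w (mem_univ w)
  · rw [← h2]; split_ifs <;> simp
  · split_ifs with h
    · exact card_pos.2 (nonempty_iff_ne_empty.2 h)
    · exact Nat.zero_le _

set_option linter.unusedSectionVars false in
lemma prod_le_pow_support (e : Finset ι → ℝ) (τ : κ → Finset ι) {t E : ℝ} (he : ∀ σ, 0 ≤ e σ)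
    (ht : ∀ σ : Finset ι, σ.Nonempty → e σ ≤ t) (hE : e ∅ ≤ E) :
    ∏ w, e (τ w) ≤ t ^ support τ * E ^ (Fintype.card κ - support τ) := by
  rw [← prod_filter_mul_prod_filter_not univ (fun w => τ w ≠ ∅)]
  have h1 : (univ.filter fun w => ¬ τ w ≠ ∅).card = Fintype.card κ - support τ := by
    have := card_filter_add_card_filter_not (s := (univ : Finset κ)) (fun w => τ w ≠ ∅)
    rw [card_univ] at this
    unfold support; omega
  rw [← h1, support, ← prod_const, ← prod_const]
  refine mul_le_mul (prod_le_prod (fun w _ => he _) fun w hw => ht _ ?_)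
    (prod_le_prod (fun w _ => he _) fun w hw => ?_) (prod_nonneg fun w _ => he _)
    (prod_nonneg fun w hw => ?_)
  · exact nonempty_iff_ne_empty.2 (mem_filter.1 hw).2
  · have : τ w = ∅ := by simpa using hw
    rw [this]; exact hE
  · exact (he _).trans (ht _ (nonempty_iff_ne_empty.2 (mem_filter.1 hw).2))

variable {e : Finset ι → ℝ} {t Y : ℝ}

/-- Only `|κ| - support τ` factors are empty types; counting all `|κ|` of them in the exponent costs
the last summand, which is negligible once `t` tends to zero. -/
lemma prod_le_exp (he : ∀ σ, 0 ≤ e σ) (ht0 : 0 ≤ t) (hY : 0 ≤ Y)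
    (ht : ∀ σ : Finset ι, σ.Nonempty → e σ ≤ t)
    (hE : e ∅ ≤ Real.exp (-(Fintype.card ι * t) + Y)) {h : ℕ} {τ : κ → Finset ι}
    (hτ : τ ∈ atMostTypes ι κ h) :
    ∏ w, e (τ w) ≤ t ^ support τ * Real.exp (-(Fintype.card κ * (Fintype.card ι * t)) +
      Fintype.card κ * Y + Fintype.card ι * h * (Fintype.card ι * t)) := by
  refine (prod_le_pow_support e τ he ht hE).trans ?_
  refine mul_le_mul_of_nonneg_left ?_ (pow_nonneg ht0 _)
  rw [← Real.exp_nat_mul, Real.exp_le_exp]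
  have h1 : support τ ≤ Fintype.card κ := by
    unfold support; exact card_le_univ _
  have h2 : (support τ : ℝ) ≤ Fintype.card ι * h := by
    exact_mod_cast support_le_of_mem_atMostTypes hτ
  rw [Nat.cast_sub h1]
  have h3 : 0 ≤ (Fintype.card ι : ℝ) * t := by positivity
  have h4 := mul_le_mul_of_nonneg_right h2 h3
  have h5 : 0 ≤ (support τ : ℝ) * Y := by positivity
  nlinarith

lemma sum_pow_support_le (ht0 : 0 ≤ t) (T : Finset (κ → Finset ι)) (J : ℕ)
    (hT : ∀ τ ∈ T, support τ < J) :
    ∑ τ ∈ T, t ^ support τ ≤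
      ∑ j ∈ range J, ((Fintype.card κ : ℝ) * 2 ^ Fintype.card ι) ^ j * t ^ j := by
  rw [← sum_fiberwise_of_maps_to (fun τ hτ => mem_range.2 (hT τ hτ))]
  refine sum_le_sum fun j _ => ?_
  calc ∑ τ ∈ T with support τ = j, t ^ support τ
      = ((T.filter fun τ => support τ = j).card : ℝ) * t ^ j := by
        rw [← nsmul_eq_mul, ← sum_const]
        exact sum_congr rfl fun τ hτ => by rw [(mem_filter.1 hτ).2]
    _ ≤ _ := by
        refine mul_le_mul_of_nonneg_right ?_ (pow_nonneg ht0 _)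
        have := (card_le_card (filter_subset_filter (fun τ => support τ = j)
          (subset_univ T))).trans (card_support_eq_le j)
        exact_mod_cast this

lemma sum_atMostTypes_le (he : ∀ σ, 0 ≤ e σ) (ht0 : 0 ≤ t) (hY : 0 ≤ Y)
    (ht : ∀ σ : Finset ι, σ.Nonempty → e σ ≤ t)
    (hE : e ∅ ≤ Real.exp (-(Fintype.card ι * t) + Y)) (h : ℕ) :
    ∑ τ ∈ atMostTypes ι κ h, ∏ w, e (τ w) ≤
      Real.exp (-(Fintype.card κ * (Fintype.card ι * t)) +
        Fintype.card κ * Y + Fintype.card ι * h * (Fintype.card ι * t)) *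
      ∑ j ∈ range (Fintype.card ι * h + 1),
        ((Fintype.card κ : ℝ) * 2 ^ Fintype.card ι) ^ j * t ^ j := by
  refine (sum_le_sum fun τ hτ => prod_le_exp he ht0 hY ht hE hτ).trans ?_
  rw [← sum_mul, mul_comm]
  refine mul_le_mul_of_nonneg_left ?_ (Real.exp_nonneg _)
  exact sum_pow_support_le ht0 _ _ fun τ hτ =>
    Nat.lt_succ_of_le (support_le_of_mem_atMostTypes hτ)

/-- Full support `|ι| * h` gives the leading term, with its count bounded by all of `exactTypes`;
smaller supports contribute lower powers of `|κ| * t`. -/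
lemma sum_exactTypes_le (he : ∀ σ, 0 ≤ e σ) (ht0 : 0 ≤ t) (hY : 0 ≤ Y)
    (ht : ∀ σ : Finset ι, σ.Nonempty → e σ ≤ t)
    (hE : e ∅ ≤ Real.exp (-(Fintype.card ι * t) + Y)) (h : ℕ) :
    ∑ τ ∈ exactTypes ι κ h, ∏ w, e (τ w) ≤
      Real.exp (-(Fintype.card κ * (Fintype.card ι * t)) +
        Fintype.card κ * Y + Fintype.card ι * h * (Fintype.card ι * t)) *
      (((Fintype.card κ).choose h : ℝ) ^ Fintype.card ι * t ^ (Fintype.card ι * h) +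
        ∑ j ∈ range (Fintype.card ι * h),
          ((Fintype.card κ : ℝ) * 2 ^ Fintype.card ι) ^ j * t ^ j) := by
  refine (sum_le_sum fun τ hτ => prod_le_exp he ht0 hY ht hE
    (exactTypes_subset_atMostTypes h hτ)).trans ?_
  rw [← sum_mul, mul_comm]
  refine mul_le_mul_of_nonneg_left ?_ (Real.exp_nonneg _)
  rw [← sum_filter_add_sum_filter_not _ (fun τ => support τ = Fintype.card ι * h)]
  refine add_le_add ?_ (sum_pow_support_le ht0 _ _ fun τ hτ => ?_)
  · calc ∑ τ ∈ exactTypes ι κ h with support τ = Fintype.card ι * h, t ^ support τ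
        = (((exactTypes ι κ h).filter fun τ => support τ = Fintype.card ι * h).card : ℝ) *
          t ^ (Fintype.card ι * h) := by
          rw [← nsmul_eq_mul, ← sum_const]
          exact sum_congr rfl fun τ hτ => by rw [(mem_filter.1 hτ).2]
      _ ≤ _ := by
          refine mul_le_mul_of_nonneg_right ?_ (pow_nonneg ht0 _)
          have := card_filter_le (exactTypes ι κ h) fun τ => support τ = Fintype.card ι * h
          rw [card_exactTypes] at this
          exact_mod_cast this
  · exact lt_of_le_of_ne (support_le_of_mem_atMostTypes
      (exactTypes_subset_atMostTypes h (mem_filter.1 hτ).1)) (mem_filter.1 hτ).2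

lemma le_sum_exactTypes {E : ℝ} (he : ∀ σ, 0 ≤ e σ) (ht0 : 0 ≤ t) (hE0 : 0 ≤ E) (hE1 : E ≤ 1)
    (ht : ∀ i, t ≤ e {i}) (hE : E ≤ e ∅) (h : ℕ) :
    (((Fintype.card κ).choose h : ℝ) ^ Fintype.card ι -
        ∑ j ∈ range (Fintype.card ι * h), ((Fintype.card κ : ℝ) * 2 ^ Fintype.card ι) ^ j) *
      (t ^ (Fintype.card ι * h) * E ^ Fintype.card κ) ≤
    ∑ τ ∈ exactTypes ι κ h, ∏ w, e (τ w) := by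
  set T := (exactTypes ι κ h).filter fun τ => support τ = Fintype.card ι * h
  have h1 : ((Fintype.card κ).choose h : ℝ) ^ Fintype.card ι -
      ∑ j ∈ range (Fintype.card ι * h), ((Fintype.card κ : ℝ) * 2 ^ Fintype.card ι) ^ j ≤
      T.card := by
    have a1 := card_filter_add_card_filter_not (s := exactTypes ι κ h)
      (fun τ => support τ = Fintype.card ι * h)
    rw [card_exactTypes] at a1
    -- At `t = 1` the weighted bound counts the families of deficient support.
    have a2 := sum_pow_support_le (t := 1) zero_le_one
      ((exactTypes ι κ h).filter fun τ => ¬ support τ = Fintype.card ι * h) (Fintype.card ι * h)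
      (fun τ hτ => lt_of_le_of_ne (support_le_of_mem_atMostTypes
        (exactTypes_subset_atMostTypes h (mem_filter.1 hτ).1)) (mem_filter.1 hτ).2)
    simp only [one_pow, sum_const, nsmul_eq_mul, mul_one] at a2
    have a3 : (T.card : ℝ) + ((exactTypes ι κ h).filter fun τ =>
      ¬ support τ = Fintype.card ι * h).card = ((Fintype.card κ).choose h : ℝ) ^ Fintype.card ι := by
      exact_mod_cast a1
    linarith
  calc _ ≤ (T.card : ℝ) * (t ^ (Fintype.card ι * h) * E ^ Fintype.card κ) :=
        mul_le_mul_of_nonneg_right h1 (by positivity)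
    _ = ∑ τ ∈ T, (t ^ (Fintype.card ι * h) * E ^ Fintype.card κ) := by simp
    _ ≤ ∑ τ ∈ T, ∏ w, e (τ w) := by
        refine sum_le_sum fun τ hτ => ?_
        have hτ' := mem_filter.1 hτ
        rw [← prod_filter_mul_prod_filter_not univ (fun w => τ w ≠ ∅)]
        refine mul_le_mul ?_ ?_ (by positivity) (prod_nonneg fun _ _ => he _)
        · rw [← hτ'.2, support, ← prod_const]
          refine prod_le_prod (fun _ _ => ht0) fun w hw => ?_
          have hc : (τ w).card = 1 := le_antisymm (card_le_one_of_support_eq hτ'.1 hτ'.2 w)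
            (card_pos.2 (nonempty_iff_ne_empty.2 (mem_filter.1 hw).2))
          obtain ⟨i, hi⟩ := card_eq_one.1 hc
          rw [hi]; exact ht i
        · calc E ^ Fintype.card κ ≤ E ^ (univ.filter fun w => ¬ τ w ≠ ∅).card :=
                pow_le_pow_of_le_one hE0 hE1 (card_le_univ _)
            _ = ∏ w ∈ univ.filter fun w => ¬ τ w ≠ ∅, E := by rw [prod_const]
            _ ≤ _ := by
                refine prod_le_prod (fun _ _ => hE0) fun w hw => ?_
                have : τ w = ∅ := by simpa using hw
                rw [this]; exact hE
    _ ≤ _ := sum_le_sum_of_subset_of_nonneg (filter_subset _ _)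
        fun τ _ _ => prod_nonneg fun w _ => he _

end Counting

/-! ### Explicit bounds for the joint law of the degrees -/

section Rings

variable {ι : Type*} [Fintype ι] [DecidableEq ι] {P K q : ℕ}

lemma sum_prod_ringWeight (h : K ≤ P) :
    ∑ a : ι → Finset (Fin P), ∏ i, ringWeight P K (a i) = 1 := by
  have := prod_univ_sum (fun _ : ι => (univ : Finset (Finset (Fin P))))
    (fun _ x => ringWeight P K x)
  rw [Fintype.piFinset_univ] at this
  rw [← this]; simp [sum_ringWeight h]

lemma sum_prod_ringWeight_affine (h : K ≤ P) (A B : ℝ) (G : (ι → Finset (Fin P)) → ℝ) :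
    ∑ a : ι → Finset (Fin P), (∏ i, ringWeight P K (a i)) * (A + B * G a) =
      A + B * ∑ a : ι → Finset (Fin P), (∏ i, ringWeight P K (a i)) * G a := by
  simp_rw [mul_add, sum_add_distrib]
  rw [← sum_mul, sum_prod_ringWeight h, one_mul, mul_sum]
  congr 1
  exact sum_congr rfl fun a _ => by ring

set_option linter.unusedSectionVars false in
lemma prod_ringWeight_nonneg (a : ι → Finset (Fin P)) : 0 ≤ ∏ i, ringWeight P K (a i) :=
  prod_nonneg fun _ _ => ringWeight_nonneg _ _ _

set_option linter.unusedSectionVars false in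
lemma card_eq_of_prod_ringWeight_ne_zero {a : ι → Finset (Fin P)}
    (ha : ∏ i, ringWeight P K (a i) ≠ 0) (i : ι) : (a i).card = K := by
  by_contra h
  exact ha (prod_eq_zero (mem_univ i) (by simp [ringWeight, h]))

/-- Average over the ring at `j` first, with all the others frozen; only rings of size `K` carry
weight. -/
lemma sum_prod_ringWeight_pair_le (h : K ≤ P) {i j : ι} (hij : i ≠ j)
    (f : Finset (Fin P) → Finset (Fin P) → ℝ) (B : ℝ)
    (hf : ∀ A : Finset (Fin P), A.card = K → ∑ x, ringWeight P K x * f A x ≤ B) :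
    ∑ a : ι → Finset (Fin P), (∏ k, ringWeight P K (a k)) * f (a i) (a j) ≤ B := by
  rw [Fintype.sum_equiv (Equiv.funSplitAt j (Finset (Fin P))) _
    (fun y => (ringWeight P K y.1 * ∏ k, ringWeight P K (y.2 k)) * f (y.2 ⟨i, hij⟩) y.1)]
  · rw [Fintype.sum_prod_type, sum_comm]
    calc _ = ∑ b : {k // k ≠ j} → Finset (Fin P), (∏ k, ringWeight P K (b k)) *
          ∑ x, ringWeight P K x * f (b ⟨i, hij⟩) x := by
          refine sum_congr rfl fun b _ => ?_
          rw [mul_sum]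
          exact sum_congr rfl fun x _ => by ring
      _ ≤ ∑ b : {k // k ≠ j} → Finset (Fin P), (∏ k, ringWeight P K (b k)) * B := by
          refine sum_le_sum fun b _ => ?_
          by_cases hb : ∏ k, ringWeight P K (b k) = 0
          · simp [hb]
          · exact mul_le_mul_of_nonneg_left (hf _ (card_eq_of_prod_ringWeight_ne_zero hb _))
              (prod_ringWeight_nonneg b)
      _ = B := by rw [← sum_mul, sum_prod_ringWeight h, one_mul]
  · intro a
    simp only [Equiv.funSplitAt_apply]
    congr 1
    rw [← mul_prod_erase univ _ (mem_univ j)]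
    congr 1
    rw [← prod_subtype (univ.erase j) (p := fun k => k ≠ j) (by simp)
      (fun k => ringWeight P K (a k))]

/-- The exponential of the total overlap of a family that is not pairwise disjoint. -/
lemma exp_overlap_le {a : ι → Finset (Fin P)} (ha : ¬ Spread a) {c z : ℝ} (hc : 0 ≤ c)
    (hz : Real.exp (c * (Fintype.card ι : ℝ) ^ 2) ≤ z) :
    Real.exp (c * ∑ i, ∑ j, if i = j then 0 else ((a i ∩ a j).card : ℝ)) ≤
      ∑ i, ∑ j, if i = j then 0 else
        (if (a i ∩ a j).Nonempty then z ^ (a i ∩ a j).card else 0) := by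
  have hz0 : 0 ≤ z := (Real.exp_nonneg _).trans hz
  unfold Spread at ha
  push Not at ha
  obtain ⟨i₀, j₀, hne, hnd⟩ := ha
  -- The pair of largest overlap bounds the total overlap up to `|ι| ^ 2`, and its overlap is
  -- nonempty because the family is not spread. This avoids exponential moments of several pairs
  -- jointly.
  obtain ⟨⟨i, j⟩, hij, hmax⟩ := exists_max_image
    ((univ : Finset (ι × ι)).filter fun x => x.1 ≠ x.2) (fun x => (a x.1 ∩ a x.2).card)
    ⟨(i₀, j₀), by simpa using hne⟩
  have hij' : i ≠ j := by simpa using hij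
  have hpos : (a i ∩ a j).Nonempty := by
    rw [← card_pos]
    refine lt_of_lt_of_le (card_pos.2 ?_) (hmax (i₀, j₀) (by simpa using hne))
    rw [nonempty_iff_ne_empty]
    exact fun h => hnd (disjoint_iff_inter_eq_empty.2 h)
  have h1 : ∑ i', ∑ j', (if i' = j' then 0 else ((a i' ∩ a j').card : ℝ)) ≤
      (Fintype.card ι : ℝ) ^ 2 * (a i ∩ a j).card := by
    calc _ ≤ ∑ i' : ι, ∑ j' : ι, ((a i ∩ a j).card : ℝ) := by
          refine sum_le_sum fun i' _ => sum_le_sum fun j' _ => ?_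
          split_ifs with h
          · positivity
          · exact_mod_cast hmax (i', j') (by simpa using h)
      _ = _ := by simp [sq, mul_assoc]
  have hn : ∀ i' j', (0 : ℝ) ≤ if i' = j' then 0 else
      (if (a i' ∩ a j').Nonempty then z ^ (a i' ∩ a j').card else 0) := by
    intro i' j'; split_ifs <;> positivity
  calc _ ≤ Real.exp ((a i ∩ a j).card * (c * (Fintype.card ι : ℝ) ^ 2)) := by
        rw [Real.exp_le_exp]
        calc _ ≤ c * ((Fintype.card ι : ℝ) ^ 2 * (a i ∩ a j).card) :=
              mul_le_mul_of_nonneg_left h1 hc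
          _ = _ := by ring
    _ = Real.exp (c * (Fintype.card ι : ℝ) ^ 2) ^ (a i ∩ a j).card := Real.exp_nat_mul _ _
    _ ≤ z ^ (a i ∩ a j).card := pow_le_pow_left₀ (Real.exp_nonneg _) hz _
    _ = if i = j then 0 else (if (a i ∩ a j).Nonempty then z ^ (a i ∩ a j).card else 0) := by
        rw [if_neg hij', if_pos hpos]
    _ ≤ ∑ j', if i = j' then 0 else (if (a i ∩ a j').Nonempty then z ^ (a i ∩ a j').card else 0) :=
        single_le_sum (f := fun j' => if i = j' then 0 else
          (if (a i ∩ a j').Nonempty then z ^ (a i ∩ a j').card else 0))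
          (fun j' _ => hn i j') (mem_univ j)
    _ ≤ _ := single_le_sum (f := fun i' => ∑ j', if i' = j' then 0 else
          (if (a i' ∩ a j').Nonempty then z ^ (a i' ∩ a j').card else 0))
          (fun i' _ => sum_nonneg fun j' _ => hn i' j') (mem_univ i)

open Classical in
lemma sum_not_spread_le (h : K ≤ P) (hK : 0 < K) {c z : ℝ} (hc : 0 ≤ c)
    (hz : Real.exp (c * (Fintype.card ι : ℝ) ^ 2) ≤ z) (hz2 : 2 ≤ z) :
    ∑ a : ι → Finset (Fin P), (∏ i, ringWeight P K (a i)) * (if Spread a then 0 else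
        Real.exp (c * ∑ i, ∑ j, if i = j then 0 else ((a i ∩ a j).card : ℝ))) ≤
      (Fintype.card ι : ℝ) ^ 2 * (2 * (Real.exp (z * ((K : ℝ) ^ 2 / P)) - 1)) := by
  have hB : 0 ≤ 2 * (Real.exp (z * ((K : ℝ) ^ 2 / P)) - 1) := by
    have : 1 ≤ Real.exp (z * ((K : ℝ) ^ 2 / P)) := Real.one_le_exp (by positivity)
    linarith
  have hz0 : 0 ≤ z := by linarith
  calc _ ≤ ∑ a : ι → Finset (Fin P), (∏ i, ringWeight P K (a i)) *
        ∑ i, ∑ j, if i = j then 0 else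
          (if (a i ∩ a j).Nonempty then z ^ (a i ∩ a j).card else 0) := by
        refine sum_le_sum fun a _ => mul_le_mul_of_nonneg_left ?_ (prod_ringWeight_nonneg a)
        split_ifs with ha
        · exact sum_nonneg fun i _ => sum_nonneg fun j _ => by split_ifs <;> positivity
        · exact exp_overlap_le ha hc hz
    _ = ∑ i : ι, ∑ j : ι, ∑ a : ι → Finset (Fin P), (∏ i, ringWeight P K (a i)) *
          if i = j then 0 else (if (a i ∩ a j).Nonempty then z ^ (a i ∩ a j).card else 0) := by
        simp_rw [mul_sum]
        rw [sum_comm]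
        exact sum_congr rfl fun i _ => sum_comm
    _ ≤ ∑ i : ι, ∑ j : ι, 2 * (Real.exp (z * ((K : ℝ) ^ 2 / P)) - 1) := by
        refine sum_le_sum fun i _ => sum_le_sum fun j _ => ?_
        by_cases hij : i = j
        · simpa [hij] using hB
        · simp_rw [if_neg hij]
          exact sum_prod_ringWeight_pair_le h hij
            (fun A x => if (A ∩ x).Nonempty then z ^ (A ∩ x).card else 0) _
            fun A hA => sum_ringWeight_pow_inter_le h hK hA hz2
    _ = _ := by simp [sq]; ring

/-- Replaces `(K ^ 2 / P) ^ q` by `C` times the sharing probability in `bothProb_le`; multiplying by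
`p ^ 2` then gives `t ^ 2` for the first term and `p * t` for the second. -/
lemma pairSum_le (hq : 1 ≤ q) (h : K ≤ P) (hK : 0 < K) {p C t : ℝ}
    (hC : ((K : ℝ) ^ 2 / P) ^ q ≤ C * keyShareProb P K q) (ht : p * keyShareProb P K q = t)
    {a : ι → Finset (Fin P)} (ha : ∀ i, (a i).card = K) :
    pairSum P K q p a ≤ (Fintype.card ι : ℝ) ^ 2 * (C ^ 2 * t ^ 2) +
      C * p * t / K * ∑ i, ∑ j, if i = j then 0 else ((a i ∩ a j).card : ℝ) := by
  have h1 : ∀ i j : ι, (if i = j then 0 else p ^ 2 * bothProb P K q (a i) (a j)) ≤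
      C ^ 2 * t ^ 2 + C * p * t / K * (if i = j then 0 else ((a i ∩ a j).card : ℝ)) := by
    intro i j
    split_ifs
    · rw [mul_zero, add_zero]; positivity
    · have e0 : 0 ≤ ((K : ℝ) ^ 2 / P) ^ q := by positivity
      have e1 := bothProb_le hq h hK (ha i) (ha j)
      have e2 : ((K : ℝ) ^ 2 / P) ^ (2 * q) ≤ (C * keyShareProb P K q) ^ 2 := by
        rw [mul_comm 2 q, pow_mul]; exact pow_le_pow_left₀ e0 hC _
      have e3 : ((a i ∩ a j).card / K : ℝ) * ((K : ℝ) ^ 2 / P) ^ q ≤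
          ((a i ∩ a j).card / K : ℝ) * (C * keyShareProb P K q) :=
        mul_le_mul_of_nonneg_left hC (by positivity)
      calc p ^ 2 * bothProb P K q (a i) (a j)
          ≤ p ^ 2 * ((C * keyShareProb P K q) ^ 2 +
            ((a i ∩ a j).card / K : ℝ) * (C * keyShareProb P K q)) :=
            mul_le_mul_of_nonneg_left (by linarith) (sq_nonneg p)
        _ = _ := by rw [← ht]; ring
  calc pairSum P K q p a ≤ ∑ i, ∑ j, (C ^ 2 * t ^ 2 +
        C * p * t / K * (if i = j then 0 else ((a i ∩ a j).card : ℝ))) :=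
        sum_le_sum fun i _ => sum_le_sum fun j _ => h1 i j
    _ = _ := by
        simp_rw [sum_add_distrib]
        congr 1
        · simp [sq, mul_assoc]
        · simp_rw [mul_sum]

lemma Spread.overlap_eq_zero {a : ι → Finset (Fin P)} (ha : Spread a) :
    ∑ i, ∑ j, (if i = j then 0 else ((a i ∩ a j).card : ℝ)) = 0 := by
  refine sum_eq_zero fun i _ => sum_eq_zero fun j _ => ?_
  split_ifs with hij
  · rfl
  · rw [disjoint_iff_inter_eq_empty.1 (ha i j hij)]; simp

end Rings

section Network

variable {n P K q : ℕ} {p : unitInterval} {C : ℝ}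

lemma linkProb_eq_mul_shareProb (h : K ≤ P) {A : Finset (Fin P)} (hA : A.card = K) :
    (p : ℝ) * shareProb P K q A = linkProb P K q p := by
  rw [linkProb, keyShareProb_eq h hA]

lemma linkProb_nonneg : 0 ≤ linkProb P K q p :=
  mul_nonneg p.2.1 measureReal_nonneg

lemma card_outside (V : Finset (Fin n)) : Fintype.card {w // w ∉ V} = n - V.card := by
  rw [Fintype.card_subtype_compl]; simp

open Classical in
/-- Upper bound for the probability that all nodes of `V` have degree `h`. -/
lemma networkLaw_deg_le_explicit (hq : 1 ≤ q) (hKP : K ≤ P) (hK : 0 < K)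
    (hC0 : 0 ≤ C) (hC : ((K : ℝ) ^ 2 / P) ^ q ≤ C * keyShareProb P K q) (V : Finset (Fin n))
    (h : ℕ) {t z : ℝ} (ht : linkProb P K q p = t) (hz2 : 2 ≤ z)
    (hz : Real.exp ((n - V.card : ℕ) * (C * p * t / K) * (V.card : ℝ) ^ 2) ≤ z) :
    (networkLaw n P K p).real {ω | ∀ i ∈ V, deg q ω i = h} ≤
      Real.exp (-((n - V.card : ℕ) * (V.card * t)) +
        (n - V.card : ℕ) * ((V.card : ℝ) ^ 2 * (C ^ 2 * t ^ 2)) + V.card * h * (V.card * t)) *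
      ((((n - V.card).choose h : ℝ) ^ V.card * t ^ (V.card * h) +
        ∑ j ∈ range (V.card * h), (((n - V.card : ℕ) : ℝ) * 2 ^ V.card) ^ j * t ^ j) +
        (∑ j ∈ range (V.card * h + 1), (((n - V.card : ℕ) : ℝ) * 2 ^ V.card) ^ j * t ^ j) *
          ((V.card : ℝ) ^ 2 * (2 * (Real.exp (z * ((K : ℝ) ^ 2 / P)) - 1)))) := by
  have hp := p.2.1
  have hp1 := p.2.2
  have ht0 : 0 ≤ t := ht ▸ linkProb_nonneg
  set m := V.card
  set r := n - m
  set X := -((r : ℝ) * (m * t)) + r * ((m : ℝ) ^ 2 * (C ^ 2 * t ^ 2)) + m * h * (m * t)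
  set S1 := ((r.choose h : ℝ) ^ m * t ^ (m * h) + ∑ j ∈ range (m * h), ((r : ℝ) * 2 ^ m) ^ j * t ^ j)
  set S2 := ∑ j ∈ range (m * h + 1), ((r : ℝ) * 2 ^ m) ^ j * t ^ j
  have hS1 : 0 ≤ S1 := by positivity
  have hS2 : 0 ≤ S2 := by positivity
  have hι : Fintype.card {i // i ∈ V} = m := by simp [m]
  have hκ : Fintype.card {w // w ∉ V} = r := card_outside V
  set c := (r : ℝ) * (C * p * t / K)
  have hc : 0 ≤ c := by positivity
  have key : ∀ a : {i // i ∈ V} → Finset (Fin P), (∀ i, (a i).card = K) →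
      ∑ τ ∈ (if Spread a then exactTypes {i // i ∈ V} {w // w ∉ V} h
          else atMostTypes {i // i ∈ V} {w // w ∉ V} h), ∏ w, typeProb P K q p a (τ w) ≤
      Real.exp X * S1 + Real.exp X * S2 * (if Spread a then 0 else
        Real.exp (c * ∑ i, ∑ j, if i = j then 0 else ((a i ∩ a j).card : ℝ))) := by
    intro a ha
    have hta : ∀ i, (p : ℝ) * shareProb P K q (a i) = t := fun i => by
      rw [linkProb_eq_mul_shareProb hKP (ha i), ht]
    have hY := pairSum_le (t := t) hq hKP hK hC (by rw [← ht, linkProb]) ha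
    have e1 : ∀ σ : Finset {i // i ∈ V}, σ.Nonempty → typeProb P K q p a σ ≤ t := by
      rintro σ ⟨i, hi⟩
      exact (typeProb_le hp hp1 hi).trans (hta i).le
    have e2 := typeProb_empty_le hKP hp hp1 hta
    have e3 : ∀ s, -((r : ℝ) * (m * t)) + r * pairSum P K q p a + m * h * (m * t) ≤ X + c * s ↔
        r * pairSum P K q p a ≤ r * ((m : ℝ) ^ 2 * (C ^ 2 * t ^ 2)) + c * s := by
      intro s
      constructor <;> intro h' <;> simp only [X] at * <;> linarith
    rw [hι] at hY
    have e4 : ∀ s, s = ∑ i, ∑ j, (if i = j then 0 else ((a i ∩ a j).card : ℝ)) →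
        -((r : ℝ) * (m * t)) + r * pairSum P K q p a + m * h * (m * t) ≤ X + c * s := by
      intro s hs
      rw [e3, hs]
      calc _ ≤ _ := mul_le_mul_of_nonneg_left hY (Nat.cast_nonneg r)
        _ = _ := by simp only [c]; ring
    split_ifs with hs
    · have := sum_exactTypes_le (κ := {w // w ∉ V}) (fun σ => typeProb_nonneg hp hp1 σ) ht0
        pairSum_nonneg e1 e2 h
      rw [hι, hκ] at this
      refine this.trans ?_
      rw [mul_zero, add_zero]
      refine mul_le_mul_of_nonneg_right (Real.exp_le_exp.2 ?_) hS1
      have := e4 _ rfl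
      rwa [hs.overlap_eq_zero, mul_zero, add_zero] at this
    · have := sum_atMostTypes_le (κ := {w // w ∉ V}) (fun σ => typeProb_nonneg hp hp1 σ) ht0
        pairSum_nonneg e1 e2 h
      rw [hι, hκ] at this
      refine this.trans ?_
      have e7 : 0 ≤ Real.exp X * S1 := by positivity
      refine (mul_le_mul_of_nonneg_right (Real.exp_le_exp.2 (e4 _ rfl)) hS2).trans ?_
      rw [Real.exp_add X, mul_right_comm]
      exact le_add_of_nonneg_left e7
  calc _ ≤ _ := networkLaw_deg_le hq hKP p V h
    _ ≤ ∑ a : {i // i ∈ V} → Finset (Fin P), (∏ i, ringWeight P K (a i)) *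
        (Real.exp X * S1 + Real.exp X * S2 * (if Spread a then 0 else
        Real.exp (c * ∑ i, ∑ j, if i = j then 0 else ((a i ∩ a j).card : ℝ)))) := by
        refine sum_le_sum fun a _ => ?_
        by_cases hb : ∏ k, ringWeight P K (a k) = 0
        · rw [hb, zero_mul, zero_mul]
        · exact mul_le_mul_of_nonneg_left (key a (card_eq_of_prod_ringWeight_ne_zero hb))
            (prod_ringWeight_nonneg a)
    _ = Real.exp X * S1 + Real.exp X * S2 *
        ∑ a : {i // i ∈ V} → Finset (Fin P), (∏ i, ringWeight P K (a i)) * (if Spread a then 0 else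
        Real.exp (c * ∑ i, ∑ j, if i = j then 0 else ((a i ∩ a j).card : ℝ))) := by
        exact sum_prod_ringWeight_affine hKP _ _ _
    _ ≤ Real.exp X * S1 + Real.exp X * S2 *
        ((m : ℝ) ^ 2 * (2 * (Real.exp (z * ((K : ℝ) ^ 2 / P)) - 1))) := by
        have := sum_not_spread_le (ι := {i // i ∈ V}) (z := z) hKP hK hc (by rw [hι]; exact hz) hz2
        rw [hι] at this
        have h8 : 0 ≤ Real.exp X * S2 := by positivity
        have := mul_le_mul_of_nonneg_left this h8
        linarith
    _ = _ := by ring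

open Classical in
/-- Lower bound for the probability that all nodes of `V` have degree `h`. -/
lemma le_networkLaw_deg_explicit (hq : 1 ≤ q) (hKP : K ≤ P) (hK : 0 < K)
    (hC : ((K : ℝ) ^ 2 / P) ^ q ≤ C * keyShareProb P K q) (V : Finset (Fin n))
    (h : ℕ) {t : ℝ} (ht : linkProb P K q p = t) (hmt : V.card * t ≤ 1)
    (hCt : (V.card : ℝ) ^ 2 * (C ^ 2 * t ^ 2) ≤ t)
    (hL : ∑ j ∈ range (V.card * h), (((n - V.card : ℕ) : ℝ) * 2 ^ V.card) ^ j ≤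
      ((n - V.card).choose h : ℝ) ^ V.card) :
    (1 - (V.card : ℝ) ^ 2 * (2 * (Real.exp (2 * ((K : ℝ) ^ 2 / P)) - 1))) *
      ((((n - V.card).choose h : ℝ) ^ V.card -
        ∑ j ∈ range (V.card * h), (((n - V.card : ℕ) : ℝ) * 2 ^ V.card) ^ j) *
      ((t - (V.card : ℝ) ^ 2 * (C ^ 2 * t ^ 2)) ^ (V.card * h) *
        (1 - V.card * t) ^ (n - V.card))) ≤
    (networkLaw n P K p).real {ω | ∀ i ∈ V, deg q ω i = h} := by
  have hp := p.2.1
  have hp1 := p.2.2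
  have ht0 : 0 ≤ t := ht ▸ linkProb_nonneg
  set m := V.card
  set r := n - m
  set L := (((r.choose h : ℝ) ^ m - ∑ j ∈ range (m * h), ((r : ℝ) * 2 ^ m) ^ j) *
      ((t - (m : ℝ) ^ 2 * (C ^ 2 * t ^ 2)) ^ (m * h) * (1 - m * t) ^ r))
  have hι : Fintype.card {i // i ∈ V} = m := by simp [m]
  have hκ : Fintype.card {w // w ∉ V} = r := card_outside V
  have hmt0 : 0 ≤ 1 - m * t := by linarith
  have hL0 : 0 ≤ L := mul_nonneg (by linarith)
    (mul_nonneg (pow_nonneg (by linarith) _) (pow_nonneg hmt0 _))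
  -- The exponential with coefficient 0 is just the indicator of a family that is not spread, so
  -- `sum_not_spread_le` applies with `z = 2`.
  have key : ∀ a : {i // i ∈ V} → Finset (Fin P), (∀ i, (a i).card = K) →
      L * (1 - if Spread a then 0 else
        Real.exp (0 * ∑ i, ∑ j, if i = j then 0 else ((a i ∩ a j).card : ℝ))) ≤
      ∑ τ ∈ (if Spread a then exactTypes {i // i ∈ V} {w // w ∉ V} h else ∅),
        ∏ w, typeProb P K q p a (τ w) := by
    intro a ha
    split_ifs with hs
    · have hta : ∀ i, (p : ℝ) * shareProb P K q (a i) = t := fun i => by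
        rw [linkProb_eq_mul_shareProb hKP (ha i), ht]
      have hY := pairSum_le (t := t) hq hKP hK hC (by rw [← ht, linkProb]) ha
      rw [hs.overlap_eq_zero, mul_zero, add_zero, hι] at hY
      have e1 : ∀ i, t - (m : ℝ) ^ 2 * (C ^ 2 * t ^ 2) ≤ typeProb P K q p a {i} := by
        intro i
        have := le_typeProb_singleton (P := P) (K := K) (q := q) (a := a) hp hp1 i
        rw [hta i] at this
        linarith
      have e2 := le_typeProb_empty hKP hp hp1 hta
      rw [hι] at e2
      have := le_sum_exactTypes (κ := {w // w ∉ V}) (fun σ => typeProb_nonneg hp hp1 σ)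
        (by linarith : 0 ≤ t - (m : ℝ) ^ 2 * (C ^ 2 * t ^ 2)) hmt0
        (by have : 0 ≤ (m : ℝ) * t := by positivity
            linarith) e1 e2 h
      rw [hι, hκ] at this
      simpa using this
    · simp
  refine le_trans ?_ (le_networkLaw_deg hq hKP p V h)
  calc _ ≤ L * (1 - ∑ a : {i // i ∈ V} → Finset (Fin P), (∏ i, ringWeight P K (a i)) *
        (if Spread a then 0 else
        Real.exp (0 * ∑ i, ∑ j, if i = j then 0 else ((a i ∩ a j).card : ℝ)))) := by
        have := sum_not_spread_le (ι := {i // i ∈ V}) (z := 2) (c := 0) hKP hK le_rfl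
          (by norm_num) le_rfl
        rw [hι] at this
        rw [mul_comm]
        exact mul_le_mul_of_nonneg_left (by linarith) hL0
    _ = ∑ a : {i // i ∈ V} → Finset (Fin P), (∏ i, ringWeight P K (a i)) * (L * (1 -
        (if Spread a then 0 else
        Real.exp (0 * ∑ i, ∑ j, if i = j then 0 else ((a i ∩ a j).card : ℝ))))) := by
        have := sum_prod_ringWeight_affine hKP L (-L) (fun a : {i // i ∈ V} → Finset (Fin P) =>
          if Spread a then 0 else
          Real.exp (0 * ∑ i, ∑ j, if i = j then 0 else ((a i ∩ a j).card : ℝ)))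
        rw [mul_sub, mul_one, sub_eq_add_neg, ← neg_mul, ← this]
        exact sum_congr rfl fun a _ => by ring
    _ ≤ _ := by
        refine sum_le_sum fun a _ => ?_
        by_cases hb : ∏ k, ringWeight P K (a k) = 0
        · rw [hb, zero_mul, zero_mul]
        · exact mul_le_mul_of_nonneg_left (key a (card_eq_of_prod_ringWeight_ne_zero hb))
            (prod_ringWeight_nonneg a)

end Network

/-! ### Asymptotics of the joint law of the degrees -/

/-- The asymptotic regime of the theorem, as far as the joint law of the degrees of a bounded
number of nodes is concerned: mean degrees are asymptotic to `log n`. -/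
structure LogRegime (q : ℕ) (K P : ℕ → ℕ) (p : ℕ → unitInterval) : Prop where
  one_le : 1 ≤ q
  le_pool (n : ℕ) : K n ≤ P n
  ring_tendsto : Tendsto K atTop atTop
  ratio_tendsto : Tendsto (fun n => (K n : ℝ) ^ 2 / (P n : ℝ)) atTop (𝓝 0)
  mean_tendsto : Tendsto (fun n : ℕ => n * linkProb (P n) (K n) q (p n) / Real.log n) atTop (𝓝 1)

lemma tendsto_log_natCast : Tendsto (fun n : ℕ => Real.log n) atTop atTop :=
  Real.tendsto_log_atTop.comp tendsto_natCast_atTop_atTop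

lemma tendsto_sum_range_pow_div (J : ℕ) (c : ℝ) {x : ℕ → ℝ} (hx : Tendsto x atTop atTop) :
    Tendsto (fun n => (∑ j ∈ range J, (x n * c) ^ j) / x n ^ J) atTop (𝓝 0) := by
  simp_rw [sum_div]
  rw [← sum_const_zero (s := range J) (ι := ℕ)]
  refine tendsto_finsetSum _ fun j hj => ?_
  have hj := mem_range.1 hj
  have h1 : Tendsto (fun n => c ^ j * (x n ^ (J - j))⁻¹) atTop (𝓝 (c ^ j * 0)) :=
    (tendsto_inv_atTop_zero.comp ((tendsto_pow_atTop (by omega)).comp hx)).const_mul _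
  rw [mul_zero] at h1
  refine h1.congr' ?_
  filter_upwards [hx.eventually_gt_atTop 0] with n hn
  obtain ⟨d, rfl⟩ := Nat.exists_eq_add_of_lt hj
  rw [show j + d + 1 - j = d + 1 by omega, mul_pow, show j + d + 1 = j + (d + 1) by ring, pow_add]
  field_simp
  ring

lemma tendsto_sum_range_succ_pow_div (J : ℕ) (c : ℝ) {x : ℕ → ℝ} (hx : Tendsto x atTop atTop) :
    Tendsto (fun n => (∑ j ∈ range (J + 1), (x n * c) ^ j) / x n ^ J) atTop (𝓝 (c ^ J)) := by
  have h := (tendsto_sum_range_pow_div J c hx).add_const (c ^ J)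
  rw [zero_add] at h
  refine h.congr' ?_
  filter_upwards [hx.eventually_gt_atTop 0] with n hn
  rw [sum_range_succ, add_div, mul_pow, mul_div_cancel_left₀]
  positivity

lemma exp_neg_le_one_sub {y : ℝ} (hy2 : y ≤ 1 / 2) :
    Real.exp (-y - 2 * y ^ 2) ≤ 1 - y := by
  have h1 : 0 < 1 - y := by linarith
  -- Bounds `1 / (1 - y) = 1 + y / (1 - y)` by an exponential; for `y ≤ 1/2` its exponent is at most
  -- `y + 2 * y ^ 2`.
  have h2 := Real.add_one_le_exp (y / (1 - y))
  have h3 : y / (1 - y) + 1 = (1 - y)⁻¹ := by field_simp; ring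
  rw [h3] at h2
  have h4 : y / (1 - y) ≤ y + 2 * y ^ 2 := by
    rw [div_le_iff₀ h1]
    nlinarith [mul_nonneg (sq_nonneg y) (by linarith : 0 ≤ 1 - 2 * y)]
  have h5 := h2.trans (Real.exp_le_exp.2 h4)
  rw [show -y - 2 * y ^ 2 = -(y + 2 * y ^ 2) by ring, Real.exp_neg]
  exact inv_le_of_inv_le₀ h1 h5

namespace LogRegime

variable {q : ℕ} {K P : ℕ → ℕ} {p : ℕ → unitInterval}

lemma tendsto_mean (hR : LogRegime q K P p) :
    Tendsto (fun n : ℕ => n * linkProb (P n) (K n) q (p n)) atTop atTop := by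
  have h := hR.mean_tendsto.pos_mul_atTop one_pos tendsto_log_natCast
  refine h.congr' ?_
  filter_upwards [tendsto_log_natCast.eventually_gt_atTop 0] with n hn
  field_simp

lemma eventually_mean_le (hR : LogRegime q K P p) :
    ∀ᶠ n : ℕ in atTop, n * linkProb (P n) (K n) q (p n) ≤ 2 * Real.log n := by
  filter_upwards [hR.mean_tendsto.eventually_lt_const one_lt_two,
    tendsto_log_natCast.eventually_gt_atTop 0] with n hn hl
  exact ((div_lt_iff₀ hl).1 hn).le

lemma tendsto_mean_mul_linkProb (hR : LogRegime q K P p) :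
    Tendsto (fun n : ℕ => n * linkProb (P n) (K n) q (p n) *
    linkProb (P n) (K n) q (p n)) atTop (𝓝 0) := by
  have h0 := ((Real.tendsto_pow_mul_exp_neg_atTop_nhds_zero 2).comp tendsto_log_natCast).const_mul 4
  rw [mul_zero] at h0
  refine squeeze_zero' ?_ ?_ h0
  · exact .of_forall fun n => by
      have := linkProb_nonneg (P := P n) (K := K n) (q := q) (p := p n)
      positivity
  · filter_upwards [hR.eventually_mean_le, eventually_gt_atTop 0] with n hn hn0
    have hn0 : (0 : ℝ) < n := by exact_mod_cast hn0
    have ht := linkProb_nonneg (P := P n) (K := K n) (q := q) (p := p n)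
    simp only [Function.comp]
    rw [Real.exp_neg, Real.exp_log hn0]
    calc _ = (n * linkProb (P n) (K n) q (p n)) ^ 2 * (n : ℝ)⁻¹ := by field_simp
      _ ≤ (2 * Real.log n) ^ 2 * (n : ℝ)⁻¹ := by gcongr
      _ = _ := by ring

lemma tendsto_linkProb (hR : LogRegime q K P p) :
    Tendsto (fun n : ℕ => linkProb (P n) (K n) q (p n)) atTop (𝓝 0) := by
  refine squeeze_zero' (.of_forall fun n => linkProb_nonneg) ?_ hR.tendsto_mean_mul_linkProb
  filter_upwards [hR.tendsto_mean.eventually_ge_atTop 1] with n hn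
  exact le_mul_of_one_le_left linkProb_nonneg hn

/-- The order of the probability of sharing `q` keys. -/
lemma exists_ratio_pow_le (hR : LogRegime q K P p) : ∃ C : ℝ, 0 < C ∧ ∀ᶠ n in atTop,
    ((K n : ℝ) ^ 2 / P n) ^ q ≤ C * keyShareProb (P n) (K n) q := by
  have hq := hR.one_le
  set c : ℝ := 1 / (4 ^ q * q.factorial) with hc
  have hc0 : 0 < c := by positivity
  refine ⟨2 / c, by positivity, ?_⟩
  have hq0 : (0 : ℝ) < q := by exact_mod_cast hq
  filter_upwards [hR.ring_tendsto.eventually_ge_atTop (2 * q),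
    hR.ratio_tendsto.eventually_le_const (show 0 < c / 2 / q by positivity)] with n hK hε
  obtain ⟨A, -, hA⟩ := exists_subset_card_eq
    (show K n ≤ (univ : Finset (Fin (P n))).card by simpa using hR.le_pool n)
  have h1 := shareProb_lower hq (hR.le_pool n) hK hA
  rw [← keyShareProb_eq (hR.le_pool n) hA, ← hc] at h1
  rw [le_div_iff₀ hq0] at hε
  have h2 : ((K n : ℝ) ^ 2 / P n) ^ q * (c / 2) ≤ keyShareProb (P n) (K n) q :=
    le_trans (mul_le_mul_of_nonneg_left (by linarith) (by positivity)) h1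
  rw [div_mul_eq_mul_div, le_div_iff₀ hc0]
  linarith

/-- The exponential may grow when `p` is not small, but then the sharing probability, hence `K ^ 2 /
P`, must be small. If `p * log n ≤ 1` the exponent is bounded and `K ^ 2 / P → 0` suffices. If `p *
log n ≥ 1`, the sharing probability is at most `2 * (log n) ^ 2 / n`, while the `q`-th power of the
exponential is at most `n ^ (1/2)`. -/
lemma tendsto_exp_overlap (hR : LogRegime q K P p) (C D : ℝ) (hC0 : 0 < C) (hD : 0 ≤ D)
    (hC : ∀ᶠ n in atTop, ((K n : ℝ) ^ 2 / P n) ^ q ≤ C * keyShareProb (P n) (K n) q) :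
    Tendsto (fun n : ℕ => 2 * Real.exp (D * (n * linkProb (P n) (K n) q (p n)) * p n / K n) *
      ((K n : ℝ) ^ 2 / P n)) atTop (𝓝 0) := by
  have hq := hR.one_le
  have hq0 : q ≠ 0 := by omega
  set u : ℕ → ℝ := fun n => 2 * Real.exp (D * (n * linkProb (P n) (K n) q (p n)) * p n / K n) *
      ((K n : ℝ) ^ 2 / P n)
  have hu0 : ∀ n, 0 ≤ u n := fun n => by positivity
  -- The hypothesis bounds only the `q`-th power of `K ^ 2 / P`.
  suffices h : Tendsto (fun n => u n ^ q) atTop (𝓝 0) by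
    have h1 := h.rpow_const (p := (q : ℝ)⁻¹) (Or.inr (by positivity))
    rw [Real.zero_rpow (by positivity)] at h1
    exact h1.congr fun n => Real.pow_rpow_inv_natCast (hu0 n) hq0
  have l1 : Tendsto (fun n : ℕ => (2 * Real.exp (2 * D)) ^ q * ((K n : ℝ) ^ 2 / P n) ^ q +
      2 ^ q * (2 * C) * (2 ^ 2 * ((Real.log n / 2) ^ 2 * Real.exp (-(Real.log n / 2)))))
      atTop (𝓝 0) := by
    have a1 := (hR.ratio_tendsto.pow q).const_mul ((2 * Real.exp (2 * D)) ^ q)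
    have a2 := ((Real.tendsto_pow_mul_exp_neg_atTop_nhds_zero 2).comp
      (tendsto_log_natCast.atTop_div_const two_pos)).const_mul (2 ^ 2 : ℝ)
    have a3 := a1.add (a2.const_mul (2 ^ q * (2 * C)))
    simpa [zero_pow hq0] using a3
  refine squeeze_zero' (.of_forall fun n => pow_nonneg (hu0 n) q) ?_ l1
  have hKr : Tendsto (fun n => (K n : ℝ)) atTop atTop :=
    tendsto_natCast_atTop_atTop.comp hR.ring_tendsto
  filter_upwards [hC, hR.eventually_mean_le, tendsto_log_natCast.eventually_gt_atTop 0,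
    -- The threshold `4 * q * D` makes `q * D * x * p / K ≤ log n / 2`, given `x ≤ 2 * log n`.
    hKr.eventually_ge_atTop 1, hKr.eventually_ge_atTop (4 * q * D), eventually_gt_atTop 0]
    with n hCn hx hl hK1 hKD hn0
  have hn0 : (0 : ℝ) < n := by exact_mod_cast hn0
  have hp := (p n).2.1
  have hp1 := (p n).2.2
  have hε : 0 ≤ ((K n : ℝ) ^ 2 / P n) ^ q := by positivity
  have ht := linkProb_nonneg (P := P n) (K := K n) (q := q) (p := p n)
  set x := n * linkProb (P n) (K n) q (p n) with hxdef
  have hx0 : 0 ≤ x := by positivity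
  have hsecond : 0 ≤ 2 ^ q * (2 * C) * (2 ^ 2 * ((Real.log n / 2) ^ 2 *
    Real.exp (-(Real.log n / 2)))) := by positivity
  have hfirst : 0 ≤ (2 * Real.exp (2 * D)) ^ q * ((K n : ℝ) ^ 2 / P n) ^ q := by positivity
  have hu : u n ^ q = (2 * Real.exp (D * x * p n / K n)) ^ q * ((K n : ℝ) ^ 2 / P n) ^ q :=
    mul_pow _ _ _
  rw [hu]
  rcases le_total ((p n : ℝ) * Real.log n) 1 with hcase | hcase
  · refine le_trans ?_ (le_add_of_nonneg_right hsecond)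
    refine mul_le_mul_of_nonneg_right (pow_le_pow_left₀ (by positivity) ?_ _) hε
    refine mul_le_mul_of_nonneg_left (Real.exp_le_exp.2 ?_) zero_le_two
    have h1 : x * p n ≤ 2 := by nlinarith
    calc D * x * p n / K n ≤ D * x * p n := div_le_self (by positivity) hK1
      _ = D * (x * p n) := by ring
      _ ≤ D * 2 := mul_le_mul_of_nonneg_left h1 hD
      _ = _ := by ring
  · refine le_trans ?_ (le_add_of_nonneg_left hfirst)
    have h1 : (2 * Real.exp (D * x * p n / K n)) ^ q ≤ 2 ^ q * Real.exp (Real.log n / 2) := by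
      rw [mul_pow, ← Real.exp_nat_mul]
      refine mul_le_mul_of_nonneg_left (Real.exp_le_exp.2 ?_) (by positivity)
      rw [← mul_div_assoc, div_le_iff₀ (by linarith)]
      calc (q : ℝ) * (D * x * p n) = q * D * (x * p n) := by ring
        _ ≤ q * D * (2 * Real.log n * 1) := by gcongr
        _ = (4 * q * D) * (Real.log n / 2) := by ring
        _ ≤ K n * (Real.log n / 2) := by gcongr
        _ = _ := by ring
    have h2 : ((K n : ℝ) ^ 2 / P n) ^ q ≤ C * (2 * Real.log n ^ 2 * Real.exp (-Real.log n)) := by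
      refine hCn.trans (mul_le_mul_of_nonneg_left ?_ hC0.le)
      rw [Real.exp_neg, Real.exp_log hn0, ← div_eq_mul_inv, le_div_iff₀ hn0]
      have hs : 0 ≤ keyShareProb (P n) (K n) q := measureReal_nonneg
      calc keyShareProb (P n) (K n) q * n
          ≤ keyShareProb (P n) (K n) q * n * ((p n : ℝ) * Real.log n) :=
            le_mul_of_one_le_right (by positivity) hcase
        _ = x * Real.log n := by rw [hxdef, linkProb]; ring
        _ ≤ 2 * Real.log n * Real.log n := by gcongr
        _ = _ := by ring
    calc _ ≤ 2 ^ q * Real.exp (Real.log n / 2) *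
          (C * (2 * Real.log n ^ 2 * Real.exp (-Real.log n))) :=
          mul_le_mul h1 h2 hε (by positivity)
      _ = 2 ^ q * (2 * C) * Real.log n ^ 2 *
          (Real.exp (Real.log n / 2) * Real.exp (-Real.log n)) := by ring
      _ = _ := by
          rw [← Real.exp_add, show Real.log n / 2 + -Real.log n = -(Real.log n / 2) by ring]; ring

end LogRegime

/-! ### Uniform Poisson estimates for the joint degrees -/

/-- The Poisson approximation `x ^ h / h! * exp (-x)` of the probability of degree `h`. -/
noncomputable def poissonMass (h : ℕ) (x : ℝ) : ℝ := x ^ h / h.factorial * Real.exp (-x)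

lemma poissonMass_pow (h m : ℕ) (x : ℝ) :
    poissonMass h x ^ m = x ^ (m * h) / (h.factorial : ℝ) ^ m * Real.exp (-(m * x)) := by
  rw [poissonMass, mul_pow, div_pow, ← pow_mul, mul_comm h m, ← Real.exp_nat_mul]
  congr 2; ring

lemma sum_range_pow_mul_pow_le (J : ℕ) {r n c t : ℝ} (hr0 : 0 ≤ r) (hr : r ≤ n) (hc : 0 ≤ c)
    (ht : 0 ≤ t) : ∑ j ∈ range J, (r * c) ^ j * t ^ j ≤ ∑ j ∈ range J, (n * t * c) ^ j := by
  refine sum_le_sum fun j _ => ?_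
  rw [← mul_pow]
  refine pow_le_pow_left₀ (by positivity) ?_ j
  calc r * c * t = r * (c * t) := by ring
    _ ≤ n * (c * t) := by gcongr
    _ = _ := by ring

lemma factor_main_term {X f : ℝ} (E F s₁ s₂ d : ℝ) (hX : X ≠ 0) (hf : f ≠ 0) :
    E * F * ((X / f + s₁) + s₂ * d) =
      E * (1 + f * (s₁ / X) + f * (s₂ / X) * d) * (X / f * F) := by
  field_simp

namespace LogRegime

variable {q : ℕ} {K P : ℕ → ℕ} {p : ℕ → unitInterval}

lemma joint_upper (hR : LogRegime q K P p) (m h : ℕ) : ∃ hi : ℕ → ℝ, Tendsto hi atTop (𝓝 1) ∧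
    ∀ᶠ n : ℕ in atTop, ∀ V : Finset (Fin n), V.card = m →
      (networkLaw n (P n) (K n) (p n)).real {ω | ∀ i ∈ V, deg q ω i = h} ≤
        hi n * poissonMass h (n * linkProb (P n) (K n) q (p n)) ^ m := by
  obtain ⟨C, hC0, hC⟩ := hR.exists_ratio_pow_le
  set t : ℕ → ℝ := fun n => linkProb (P n) (K n) q (p n) with ht
  set x : ℕ → ℝ := fun n => n * t n with hx
  -- The factor 2 secures `2 ≤ z n`, and the exponential dominates the overlap cost of the explicit
  -- bound.
  set z : ℕ → ℝ := fun n => 2 * Real.exp (C * (m : ℝ) ^ 2 * x n * p n / K n) with hz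
  set δ : ℕ → ℝ := fun n => (m : ℝ) ^ 2 * (2 * (Real.exp (z n * ((K n : ℝ) ^ 2 / P n)) - 1)) with hδ
  set f : ℝ := (h.factorial : ℝ) ^ m with hf
  have hf0 : 0 < f := by positivity
  have hxt : Tendsto x atTop atTop := hR.tendsto_mean
  have htt : Tendsto t atTop (𝓝 0) := hR.tendsto_linkProb
  have hxx : Tendsto (fun n => x n * t n) atTop (𝓝 0) := hR.tendsto_mean_mul_linkProb
  have hδt : Tendsto δ atTop (𝓝 0) := by
    have h1 := hR.tendsto_exp_overlap C (C * (m : ℝ) ^ 2) hC0 (by positivity) hC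
    have h2 := ((((Real.continuous_exp.tendsto 0).comp h1).sub_const 1).const_mul 2).const_mul
      ((m : ℝ) ^ 2)
    simpa using h2
  -- The exponent collects the loss from `n - m` in place of `n`, the pair correction, and the cost
  -- of nonempty types. The second factor adds to 1 the deficient supports and the overlapping
  -- rings.
  refine ⟨fun n => Real.exp ((m : ℝ) ^ 2 * t n + (m : ℝ) ^ 2 * C ^ 2 * (x n * t n) +
      (m : ℝ) ^ 2 * h * t n) *
      (1 + f * ((∑ j ∈ range (m * h), (x n * 2 ^ m) ^ j) / x n ^ (m * h)) +
        f * ((∑ j ∈ range (m * h + 1), (x n * 2 ^ m) ^ j) / x n ^ (m * h)) * δ n), ?_, ?_⟩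
  · have e1 := (Real.continuous_exp.tendsto 0).comp (f := fun n => (m : ℝ) ^ 2 * t n +
      (m : ℝ) ^ 2 * C ^ 2 * (x n * t n) + (m : ℝ) ^ 2 * h * t n) (x := atTop) (by
        have := ((htt.const_mul ((m : ℝ) ^ 2)).add (hxx.const_mul ((m : ℝ) ^ 2 * C ^ 2))).add
          (htt.const_mul ((m : ℝ) ^ 2 * h))
        simpa using this)
    have e2 := (tendsto_sum_range_pow_div (m * h) (2 ^ m) hxt).const_mul f
    have e3 := ((tendsto_sum_range_succ_pow_div (m * h) (2 ^ m) hxt).const_mul f).mul hδt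
    have e4 := e1.mul ((e2.const_add 1).add e3)
    simpa using e4
  · have hK1 := hR.ring_tendsto.eventually_ge_atTop 1
    filter_upwards [hC, hK1, hxt.eventually_gt_atTop 0, eventually_ge_atTop m] with n hCn hK hx0 hnm
      V hV
    subst hV
    set m := V.card
    have hp := (p n).2.1
    have ht0 : 0 ≤ t n := linkProb_nonneg
    have hrn : ((n - m : ℕ) : ℝ) ≤ n := by exact_mod_cast Nat.sub_le n m
    have hz2 : 2 ≤ z n := by
      have : 1 ≤ Real.exp (C * (m : ℝ) ^ 2 * x n * p n / K n) := Real.one_le_exp (by positivity)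
      simp only [hz]; linarith
    have hzexp : Real.exp ((n - m : ℕ) * (C * p n * t n / K n) * (m : ℝ) ^ 2) ≤ z n := by
      have h1 : ((n - m : ℕ) : ℝ) * (C * p n * t n / K n) * (m : ℝ) ^ 2 ≤
          C * (m : ℝ) ^ 2 * x n * p n / K n := by
        calc _ ≤ (n : ℝ) * (C * p n * t n / K n) * (m : ℝ) ^ 2 := by gcongr
          _ = _ := by simp only [hx]; ring
      have h2 := Real.exp_le_exp.2 h1
      have h3 := Real.exp_nonneg (C * (m : ℝ) ^ 2 * x n * p n / K n)
      simp only [hz]; linarith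
    have hδ0 : 0 ≤ δ n := by
      have : 1 ≤ Real.exp (z n * ((K n : ℝ) ^ 2 / P n)) := Real.one_le_exp (by positivity)
      have : 0 ≤ Real.exp (z n * ((K n : ℝ) ^ 2 / P n)) - 1 := by linarith
      simp only [hδ]; positivity
    refine (networkLaw_deg_le_explicit hR.one_le (hR.le_pool n) hK hC0.le hCn V h
      (t := t n) (z := z n) rfl hz2 hzexp).trans ?_
    have b1 : Real.exp (-((n - m : ℕ) * (m * t n)) +
        (n - m : ℕ) * ((m : ℝ) ^ 2 * (C ^ 2 * t n ^ 2)) + m * h * (m * t n)) ≤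
        Real.exp ((m : ℝ) ^ 2 * t n + (m : ℝ) ^ 2 * C ^ 2 * (x n * t n) + (m : ℝ) ^ 2 * h * t n) *
          Real.exp (-(m * x n)) := by
      rw [← Real.exp_add, Real.exp_le_exp]
      have h1 : ((n - m : ℕ) : ℝ) * ((m : ℝ) ^ 2 * (C ^ 2 * t n ^ 2)) ≤
          (n : ℝ) * ((m : ℝ) ^ 2 * (C ^ 2 * t n ^ 2)) := by gcongr
      have h2 : -(((n - m : ℕ) : ℝ) * (m * t n)) = (m : ℝ) ^ 2 * t n - m * x n := by
        rw [Nat.cast_sub hnm]; simp only [hx]; ring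
      have h3 : (n : ℝ) * ((m : ℝ) ^ 2 * (C ^ 2 * t n ^ 2)) =
          (m : ℝ) ^ 2 * C ^ 2 * (x n * t n) := by simp only [hx]; ring
      have h4 : (m : ℝ) * h * (m * t n) = (m : ℝ) ^ 2 * h * t n := by ring
      linarith
    have b2 := sum_range_pow_mul_pow_le (m * h) (c := 2 ^ m) (Nat.cast_nonneg (n - m)) hrn
      (by positivity) ht0
    have b3 := sum_range_pow_mul_pow_le (m * h + 1) (c := 2 ^ m) (Nat.cast_nonneg (n - m)) hrn
      (by positivity) ht0
    have b4 : ((n - m).choose h : ℝ) ^ m * t n ^ (m * h) ≤ x n ^ (m * h) / f := by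
      have : ((n - m).choose h : ℝ) ≤ (n : ℝ) ^ h / h.factorial :=
        (Nat.choose_le_pow_div h (n - m)).trans (by gcongr)
      calc _ ≤ ((n : ℝ) ^ h / h.factorial) ^ m * t n ^ (m * h) := by gcongr
        _ = _ := by
          simp only [hx, hf]
          rw [div_pow, ← pow_mul, mul_comm h m, mul_pow]; ring
    calc _ ≤ (Real.exp ((m : ℝ) ^ 2 * t n + (m : ℝ) ^ 2 * C ^ 2 * (x n * t n) +
          (m : ℝ) ^ 2 * h * t n) * Real.exp (-(m * x n))) *
          ((x n ^ (m * h) / f + ∑ j ∈ range (m * h), (x n * 2 ^ m) ^ j) +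
          (∑ j ∈ range (m * h + 1), (x n * 2 ^ m) ^ j) * δ n) := by
          refine mul_le_mul b1 (add_le_add (add_le_add b4 b2) (mul_le_mul_of_nonneg_right b3 hδ0))
            ?_ (by positivity)
          exact add_nonneg (by positivity) (mul_nonneg (by positivity) hδ0)
      _ = _ := by
          rw [poissonMass_pow, ← hf]
          exact factor_main_term _ _ _ _ _ (pow_pos hx0 _).ne' hf0.ne'

lemma tendsto_one_sub_div_pow (a J : ℕ) :
    Tendsto (fun n : ℕ => (1 - (a : ℝ) / n) ^ J) atTop (𝓝 1) := by
  have := ((tendsto_const_div_atTop_nhds_zero_nat (a : ℝ)).const_sub 1).pow J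
  simpa using this

lemma joint_lower (hR : LogRegime q K P p) (m h : ℕ) : ∃ lo : ℕ → ℝ, Tendsto lo atTop (𝓝 1) ∧
    ∀ᶠ n : ℕ in atTop, ∀ V : Finset (Fin n), V.card = m →
      lo n * poissonMass h (n * linkProb (P n) (K n) q (p n)) ^ m ≤
      (networkLaw n (P n) (K n) (p n)).real {ω | ∀ i ∈ V, deg q ω i = h} := by
  obtain ⟨C, hC0, hC⟩ := hR.exists_ratio_pow_le
  set t : ℕ → ℝ := fun n => linkProb (P n) (K n) q (p n) with ht
  set x : ℕ → ℝ := fun n => n * t n with hx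
  set δ : ℕ → ℝ := fun n => (m : ℝ) ^ 2 * (2 * (Real.exp (2 * ((K n : ℝ) ^ 2 / P n)) - 1)) with hδ
  set f : ℝ := (h.factorial : ℝ) ^ m with hf
  -- `A` bounds the number of full-support families relative to `n ^ (m * h) / f`, `B` is the pair
  -- correction for single neighbours, and `D` compares `(1 - m * t) ^ n` with `exp (-(m * x))`.
  set A : ℕ → ℝ := fun n => (1 - ((m + h : ℕ) : ℝ) / n) ^ (m * h) -
    f * ((∑ j ∈ range (m * h), ((n : ℝ) * 2 ^ m) ^ j) / (n : ℝ) ^ (m * h)) with hA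
  set B : ℕ → ℝ := fun n => (1 - (m : ℝ) ^ 2 * C ^ 2 * t n) ^ (m * h) with hB
  set D : ℕ → ℝ := fun n => Real.exp (-(2 * (m : ℝ) ^ 2 * (x n * t n))) with hD
  have hf0 : 0 < f := by positivity
  have hxt : Tendsto x atTop atTop := hR.tendsto_mean
  have htt : Tendsto t atTop (𝓝 0) := hR.tendsto_linkProb
  have hxx : Tendsto (fun n => x n * t n) atTop (𝓝 0) := hR.tendsto_mean_mul_linkProb
  have hδt : Tendsto δ atTop (𝓝 0) := by
    have h1 := hR.ratio_tendsto.const_mul 2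
    rw [mul_zero] at h1
    have h2 := ((((Real.continuous_exp.tendsto 0).comp h1).sub_const 1).const_mul 2).const_mul
      ((m : ℝ) ^ 2)
    simpa using h2
  have hAt : Tendsto A atTop (𝓝 1) := by
    have := (tendsto_one_sub_div_pow (m + h) (m * h)).sub
      ((tendsto_sum_range_pow_div (m * h) (2 ^ m) tendsto_natCast_atTop_atTop).const_mul f)
    rw [mul_zero, sub_zero] at this
    exact this
  have hBt : Tendsto B atTop (𝓝 1) := by
    have := ((htt.const_mul ((m : ℝ) ^ 2 * C ^ 2)).const_sub 1).pow (m * h)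
    simpa using this
  have hDt : Tendsto D atTop (𝓝 1) := by
    have := (hxx.const_mul (2 * (m : ℝ) ^ 2)).neg
    rw [mul_zero, neg_zero] at this
    have h2 := (Real.continuous_exp.tendsto 0).comp this
    rw [Real.exp_zero] at h2
    exact h2
  refine ⟨fun n => (1 - δ n) * (A n * (B n * D n)), ?_, ?_⟩
  · have := (hδt.const_sub 1).mul (hAt.mul (hBt.mul hDt))
    simpa using this
  · have ev1 : ∀ᶠ n in atTop, (m : ℝ) * t n ≤ 1 / 2 :=
      (by simpa using htt.const_mul (m : ℝ) : Tendsto (fun n => (m : ℝ) * t n) atTop (𝓝 0))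
        |>.eventually_le_const (by norm_num)
    have ev2 : ∀ᶠ n in atTop, (m : ℝ) ^ 2 * C ^ 2 * t n ≤ 1 :=
      (by simpa using htt.const_mul ((m : ℝ) ^ 2 * C ^ 2) :
        Tendsto (fun n => (m : ℝ) ^ 2 * C ^ 2 * t n) atTop (𝓝 0)).eventually_le_const (by norm_num)
    filter_upwards [hC, hR.ring_tendsto.eventually_ge_atTop 1, hxt.eventually_gt_atTop 0,
      eventually_gt_atTop (m + h), ev1, ev2, hAt.eventually_const_le one_half_lt_one,
      hδt.eventually_le_const one_pos] with n hCn hK hx0 hnm h1 h2 h3 h4 V hV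
    subst hV
    set m := V.card
    have ht0 : 0 ≤ t n := linkProb_nonneg
    have hn0 : (0 : ℝ) < n := by exact_mod_cast (by omega : 0 < n)
    have hrn : ((n - m : ℕ) : ℝ) ≤ n := by exact_mod_cast Nat.sub_le n m
    have hA0 : 0 ≤ A n := by linarith
    have hsum : ∑ j ∈ range (m * h), (((n - m : ℕ) : ℝ) * 2 ^ m) ^ j ≤
        ∑ j ∈ range (m * h), ((n : ℝ) * 2 ^ m) ^ j :=
      sum_le_sum fun j _ => pow_le_pow_left₀ (by positivity) (by gcongr) j
    have hchoose : (n : ℝ) ^ (m * h) / f * (1 - ((m + h : ℕ) : ℝ) / n) ^ (m * h) ≤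
        ((n - m).choose h : ℝ) ^ m := by
      have c1 : (n - m + 1 - h) ^ h ≤ (n - m).descFactorial h := Nat.pow_sub_le_descFactorial _ _
      have c2 : ((n - (m + h) : ℕ) : ℝ) ^ h ≤ h.factorial * (n - m).choose h := by
        have : (n - (m + h)) ^ h ≤ h.factorial * (n - m).choose h := by
          rw [← Nat.descFactorial_eq_factorial_mul_choose]
          exact (Nat.pow_le_pow_left (by omega) h).trans c1
        exact_mod_cast this
      have c3 : ((n - (m + h) : ℕ) : ℝ) = n * (1 - ((m + h : ℕ) : ℝ) / n) := by
        rw [Nat.cast_sub hnm.le]; field_simp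
      rw [c3] at c2
      have c4 : 0 ≤ (n * (1 - ((m + h : ℕ) : ℝ) / n)) ^ h := by
        rw [← c3]; positivity
      have c5 := pow_le_pow_left₀ c4 c2 m
      rw [← pow_mul, mul_comm h m, mul_pow, mul_pow] at c5
      rw [div_mul_eq_mul_div, div_le_iff₀ hf0]
      linarith
    have hAn : (n : ℝ) ^ (m * h) / f * A n ≤ ((n - m).choose h : ℝ) ^ m -
        ∑ j ∈ range (m * h), (((n - m : ℕ) : ℝ) * 2 ^ m) ^ j := by
      have : (n : ℝ) ^ (m * h) / f * A n =
          (n : ℝ) ^ (m * h) / f * (1 - ((m + h : ℕ) : ℝ) / n) ^ (m * h) -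
          ∑ j ∈ range (m * h), ((n : ℝ) * 2 ^ m) ^ j := by
        simp only [hA]
        have hn' : (n : ℝ) ^ (m * h) ≠ 0 := by positivity
        field_simp
      rw [this]; linarith
    have hAn0 : 0 ≤ (n : ℝ) ^ (m * h) / f * A n := by positivity
    have hmt : m * t n ≤ 1 := by linarith
    have hCt : (m : ℝ) ^ 2 * (C ^ 2 * t n ^ 2) ≤ t n := by
      have := mul_le_mul_of_nonneg_right h2 ht0
      nlinarith
    have hBn : t n ^ (m * h) * B n = (t n - (m : ℝ) ^ 2 * (C ^ 2 * t n ^ 2)) ^ (m * h) := by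
      simp only [hB]; rw [← mul_pow]; congr 1; ring
    have hB0 : 0 ≤ t n ^ (m * h) * B n := by rw [hBn]; exact pow_nonneg (by linarith) _
    have hmt0 : 0 ≤ (m : ℝ) * t n := by positivity
    have hDn : Real.exp (-(m * x n)) * D n ≤ (1 - m * t n) ^ (n - m) := by
      calc Real.exp (-(m * x n)) * D n
          = Real.exp (-(m * t n) - 2 * (m * t n) ^ 2) ^ n := by
            simp only [hD]
            rw [← Real.exp_add, ← Real.exp_nat_mul]
            congr 1; simp only [hx]; ring
        _ ≤ (1 - m * t n) ^ n :=
            pow_le_pow_left₀ (Real.exp_nonneg _) (exp_neg_le_one_sub h1) n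
        _ ≤ (1 - m * t n) ^ (n - m) :=
            pow_le_pow_of_le_one (by linarith) (by linarith) (Nat.sub_le n m)
    refine le_trans ?_ (le_networkLaw_deg_explicit hR.one_le (hR.le_pool n) hK hCn V h
      (t := t n) rfl hmt hCt (by linarith))
    calc _ = (1 - δ n) * ((n : ℝ) ^ (m * h) / f * A n *
          (t n ^ (m * h) * B n * (Real.exp (-(m * x n)) * D n))) := by
          rw [poissonMass_pow, ← hf]
          change _ * (x n ^ (m * h) / f * Real.exp (-(m * x n))) = _
          simp only [hx]
          rw [mul_pow]; ring
      _ ≤ _ := by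
          refine mul_le_mul_of_nonneg_left ?_ (by linarith)
          rw [← hBn]
          refine mul_le_mul hAn (mul_le_mul_of_nonneg_left hDn hB0)
            (mul_nonneg hB0 (by positivity)) (hAn0.trans hAn)

end LogRegime

/-! ### Bonferroni inequalities and convergence of the probability of zero -/

/-- For positive `N` and `M` the truncated alternating sum is `±C(N-1,M-1)`, and Pascal's rule
bounds this by `C(N,M)`. -/
lemma abs_indicator_sub_alternating_choose_le (N M : ℕ) :
    |(if N = 0 then (1 : ℝ) else 0) - ∑ j ∈ range M, (-1) ^ j * (N.choose j : ℝ)| ≤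
      N.choose M := by
  rcases M with _ | M
  · split_ifs <;> simp
  rcases N with _ | N
  · rw [sum_range_succ']
    simp
  · have h := Int.alternating_sum_range_choose_eq_choose (n := N) (m := M)
    have h' : ∑ j ∈ range (M + 1), (-1) ^ j * ((N + 1).choose j : ℝ) = (-1) ^ M * (N.choose M : ℝ) := by
      exact_mod_cast h
    rw [h', if_neg (by omega), zero_sub, abs_neg, abs_mul, abs_pow, abs_neg, abs_one, one_pow,
      one_mul, Nat.abs_cast]
    exact_mod_cast (Nat.choose_succ_succ N M) ▸ Nat.le_add_right _ _

section Moments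

variable {Ω : Type*} [MeasurableSpace Ω] [Finite Ω] [MeasurableSingletonClass Ω] (μ : Measure Ω)
  [IsProbabilityMeasure μ] (N : Ω → ℕ)

set_option linter.unusedSectionVars false in
lemma integral_indicator_eq_zero :
    ∫ ω, (if N ω = 0 then (1 : ℝ) else 0) ∂μ = μ.real {ω | N ω = 0} := by
  rw [← integral_indicator_one (Set.toFinite _).measurableSet]
  refine integral_congr_ae (.of_forall fun ω => ?_)
  by_cases h : N ω = 0 <;> simp [h]

lemma abs_real_eq_zero_sub_le (M : ℕ) :
    |μ.real {ω | N ω = 0} - ∑ j ∈ range M, (-1) ^ j * ∫ ω, ((N ω).choose j : ℝ) ∂μ| ≤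
      ∫ ω, ((N ω).choose M : ℝ) ∂μ := by
  rw [← integral_indicator_eq_zero]
  simp_rw [← integral_const_mul]
  rw [← integral_finsetSum _ (fun j _ => .of_finite), ← integral_sub .of_finite .of_finite]
  refine (abs_integral_le_integral_abs).trans ?_
  exact integral_mono .of_finite .of_finite fun ω => abs_indicator_sub_alternating_choose_le _ _

lemma real_eq_zero_le (M : ℝ) :
    μ.real {ω | N ω = 0} ≤ 1 - 2 * ((∫ ω, ((N ω).choose 1 : ℝ) ∂μ) / M) +
      (2 * ((∫ ω, ((N ω).choose 2 : ℝ) ∂μ) / M ^ 2) +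
        ((∫ ω, ((N ω).choose 1 : ℝ) ∂μ) / M) * M⁻¹) := by
  rw [← integral_indicator_eq_zero]
  have h1 : ∀ ω, (if N ω = 0 then (1 : ℝ) else 0) ≤ 1 - 2 / M * ((N ω).choose 1 : ℝ) +
      (2 / M ^ 2 * ((N ω).choose 2 : ℝ) + 1 / M ^ 2 * ((N ω).choose 1 : ℝ)) := by
    intro ω
    have h2 : ((N ω).choose 2 : ℝ) = (N ω : ℝ) * (N ω - 1) / 2 := Nat.cast_choose_two ℝ (N ω)
    rw [h2, Nat.choose_one_right]
    -- Chebyshev's argument with an approximate mean `M`: the indicator of `N = 0` is at most `(1 -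
    -- N / M) ^ 2`, written in binomial moments.
    have h3 : 1 - 2 / M * (N ω : ℝ) + (2 / M ^ 2 * ((N ω : ℝ) * (N ω - 1) / 2) +
        1 / M ^ 2 * (N ω : ℝ)) = (1 - N ω / M) ^ 2 := by ring
    rw [h3]
    split_ifs with h
    · simp [h]
    · positivity
  refine (integral_mono .of_finite .of_finite h1).trans (le_of_eq ?_)
  rw [integral_add .of_finite .of_finite, integral_sub .of_finite .of_finite,
    integral_add .of_finite .of_finite, integral_const_mul, integral_const_mul, integral_const_mul]
  simp only [integral_const, probReal_univ, smul_eq_mul, mul_one]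
  ring

end Moments

/-- Fix a truncation `M` at which both the tail of the exponential series and `lam ^ M / M!` are
small, and only then let `n` grow; finitely many moments are involved. -/
lemma tendsto_exp_neg_of_factorial_moments {f : ℕ → ℝ} {B : ℕ → ℕ → ℝ} {lam : ℝ}
    (h : ∀ᶠ n in atTop, ∀ M, |f n - ∑ j ∈ range M, (-1) ^ j * B n j| ≤ B n M)
    (hB : ∀ j, Tendsto (fun n => B n j) atTop (𝓝 (lam ^ j / j.factorial))) :
    Tendsto f atTop (𝓝 (Real.exp (-lam))) := by
  rw [Metric.tendsto_nhds]
  intro ε hε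
  have e1 : Tendsto (fun M => ∑ j ∈ range M, (-1) ^ j * (lam ^ j / j.factorial)) atTop
      (𝓝 (Real.exp (-lam))) := by
    have := (NormedSpace.expSeries_div_hasSum_exp (𝔸 := ℝ) (-lam)).tendsto_sum_nat
    rw [← Real.exp_eq_exp_ℝ] at this
    refine this.congr fun M => sum_congr rfl fun j _ => ?_
    rw [neg_pow]; ring
  have e2 := FloorSemiring.tendsto_pow_div_factorial_atTop lam
  obtain ⟨M, hM1, hM2⟩ := ((Metric.tendsto_nhds.1 e1 (ε / 3) (by positivity)).and
    (e2.eventually_lt_const (show (0 : ℝ) < ε / 3 by positivity))).exists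
  have e3 : Tendsto (fun n => ∑ j ∈ range M, (-1) ^ j * B n j) atTop
      (𝓝 (∑ j ∈ range M, (-1) ^ j * (lam ^ j / j.factorial))) :=
    tendsto_finsetSum _ fun j _ => (hB j).const_mul _
  filter_upwards [h, (hB M).eventually_lt_const hM2,
    Metric.tendsto_nhds.1 e3 (ε / 3) (by positivity)] with n hn h2 h3
  have h4 := hn M
  rw [Real.dist_eq] at *
  calc |f n - Real.exp (-lam)| ≤ |f n - ∑ j ∈ range M, (-1) ^ j * B n j| +
        |∑ j ∈ range M, (-1) ^ j * B n j - Real.exp (-lam)| := abs_sub_le _ _ _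
    _ ≤ |f n - ∑ j ∈ range M, (-1) ^ j * B n j| +
        (|∑ j ∈ range M, (-1) ^ j * B n j - ∑ j ∈ range M, (-1) ^ j * (lam ^ j / j.factorial)| +
        |∑ j ∈ range M, (-1) ^ j * (lam ^ j / j.factorial) - Real.exp (-lam)|) := by
        gcongr; exact abs_sub_le _ _ _
    _ < ε := by linarith

/-! ### The number of nodes of a given degree -/

/-- The number of nodes of degree `h`. -/
noncomputable def degCount {n P : ℕ} (q h : ℕ) (ω : Outcome n P) : ℕ :=
  (univ.filter fun v => deg q ω v = h).card

lemma integral_choose_degCount {n P K : ℕ} (hKP : K ≤ P) (p : unitInterval) (q h m : ℕ) :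
    ∫ ω, ((degCount q h ω).choose m : ℝ) ∂(networkLaw n P K p) =
      ∑ V ∈ powersetCard m (univ : Finset (Fin n)),
        (networkLaw n P K p).real {ω | ∀ i ∈ V, deg q ω i = h} := by
  classical
  have := isProbabilityMeasure_networkLaw (n := n) hKP p
  have h1 : ∀ ω : Outcome n P, ((degCount q h ω).choose m : ℝ) =
      ∑ V ∈ powersetCard m (univ : Finset (Fin n)),
        Set.indicator {ω : Outcome n P | ∀ i ∈ V, deg q ω i = h} 1 ω := by
    intro ω
    simp only [Set.indicator_apply, Set.mem_ofPred_eq, Pi.one_apply]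
    rw [sum_boole, degCount, ← card_powersetCard]
    congr 2
    ext V
    simp only [mem_powersetCard, mem_filter, true_and, subset_iff, mem_univ]
    tauto
  simp_rw [h1]
  rw [integral_finsetSum _ (fun j _ => .of_finite)]
  exact sum_congr rfl fun V _ => integral_indicator_one (Set.toFinite _).measurableSet

lemma tendsto_choose_div_pow (m : ℕ) :
    Tendsto (fun n : ℕ => (n.choose m : ℝ) / (n : ℝ) ^ m) atTop (𝓝 (1 / m.factorial)) := by
  have h := (isEquivalent_choose m)
  have h2 := (Asymptotics.isEquivalent_iff_tendsto_one (by
    filter_upwards [eventually_gt_atTop 0] with n hn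
    positivity)).1 h
  have h3 := h2.mul_const (1 / (m.factorial : ℝ))
  rw [one_mul] at h3
  refine h3.congr' ?_
  filter_upwards [eventually_gt_atTop 0] with n hn
  simp only [Pi.div_apply]
  field_simp

namespace LogRegime

variable {q : ℕ} {K P : ℕ → ℕ} {p : ℕ → unitInterval}

/-- The approximate expected number of nodes of degree `h`. -/
noncomputable def meanCount (q : ℕ) (K P : ℕ → ℕ) (p : ℕ → unitInterval) (h n : ℕ) : ℝ :=
  n * poissonMass h (n * linkProb (P n) (K n) q (p n))

lemma eventually_meanCount_pos (hR : LogRegime q K P p) (h : ℕ) :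
    ∀ᶠ n in atTop, 0 < meanCount q K P p h n := by
  filter_upwards [hR.tendsto_mean.eventually_gt_atTop 0, eventually_gt_atTop 0] with n hn hn0
  unfold meanCount poissonMass
  positivity

/-- Stated as a ratio so that it serves convergent and divergent means alike. -/
lemma tendsto_factorial_moment_div (hR : LogRegime q K P p) (h m : ℕ) :
    Tendsto (fun n => (∫ ω, ((degCount q h ω).choose m : ℝ)
      ∂(networkLaw n (P n) (K n) (p n))) / meanCount q K P p h n ^ m) atTop
      (𝓝 (1 / m.factorial)) := by
  obtain ⟨lo, hlo, hlo'⟩ := hR.joint_lower m h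
  obtain ⟨hi, hhi, hhi'⟩ := hR.joint_upper m h
  have e1 := hlo.mul (tendsto_choose_div_pow m)
  have e2 := hhi.mul (tendsto_choose_div_pow m)
  rw [one_mul] at e1 e2
  have key : ∀ n : ℕ, 0 < meanCount q K P p h n → ∀ c : ℝ,
      c * ((n.choose m : ℝ) / (n : ℝ) ^ m) =
      (∑ V ∈ powersetCard m (univ : Finset (Fin n)),
        c * poissonMass h (n * linkProb (P n) (K n) q (p n)) ^ m) / meanCount q K P p h n ^ m := by
    intro n hn c
    rw [sum_const, card_powersetCard, card_univ, Fintype.card_fin, nsmul_eq_mul, meanCount, mul_pow]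
    have h1 : (poissonMass h (n * linkProb (P n) (K n) q (p n))) ≠ 0 := by
      rintro h; simp [meanCount, h] at hn
    have h2 : (n : ℝ) ≠ 0 := by rintro h; simp [meanCount, h] at hn
    field_simp
  refine tendsto_of_tendsto_of_tendsto_of_le_of_le' e1 e2 ?_ ?_
  · filter_upwards [hlo', hR.eventually_meanCount_pos h] with n hn hpos
    rw [key n hpos, integral_choose_degCount (hR.le_pool n)]
    refine div_le_div_of_nonneg_right ?_ (by positivity)
    exact sum_le_sum fun V hV => hn V (mem_powersetCard.1 hV).2
  · filter_upwards [hhi', hR.eventually_meanCount_pos h] with n hn hpos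
    rw [key n hpos, integral_choose_degCount (hR.le_pool n)]
    refine div_le_div_of_nonneg_right ?_ (by positivity)
    exact sum_le_sum fun V hV => hn V (mem_powersetCard.1 hV).2

/-- Poisson limit for the probability that no node has degree `h`. -/
lemma tendsto_degCount_eq_zero (hR : LogRegime q K P p) (h : ℕ) {lam : ℝ}
    (hlam : Tendsto (meanCount q K P p h) atTop (𝓝 lam)) :
    Tendsto (fun n => (networkLaw n (P n) (K n) (p n)).real {ω | degCount q h ω = 0}) atTop
      (𝓝 (Real.exp (-lam))) := by
  refine tendsto_exp_neg_of_factorial_moments (B := fun n j =>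
    ∫ ω, ((degCount q h ω).choose j : ℝ) ∂(networkLaw n (P n) (K n) (p n))) ?_ fun j => ?_
  · refine .of_forall fun n M => ?_
    have := isProbabilityMeasure_networkLaw (n := n) (hR.le_pool n) (p n)
    exact abs_real_eq_zero_sub_le _ _ M
  · have e := (hR.tendsto_factorial_moment_div h j).mul (hlam.pow j)
    rw [one_div_mul_eq_div] at e
    refine e.congr' ?_
    filter_upwards [hR.eventually_meanCount_pos h] with n hn
    exact div_mul_cancel₀ _ (pow_pos hn j).ne'

/-- Second moment bound: some node has degree `h` when the expected number of such nodes
diverges. -/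
lemma tendsto_degCount_eq_zero_of_atTop (hR : LogRegime q K P p) (h : ℕ)
    (hlam : Tendsto (meanCount q K P p h) atTop atTop) :
    Tendsto (fun n => (networkLaw n (P n) (K n) (p n)).real {ω | degCount q h ω = 0}) atTop
      (𝓝 0) := by
  have e1 := hR.tendsto_factorial_moment_div h 1
  have e2 := hR.tendsto_factorial_moment_div h 2
  have e3 := tendsto_inv_atTop_zero.comp hlam
  have e4 := ((e1.const_mul 2).const_sub 1).add ((e2.const_mul 2).add (e1.mul e3))
  have : (1 : ℝ) - 2 * (1 / (Nat.factorial 1 : ℕ)) + (2 * (1 / (Nat.factorial 2 : ℕ)) +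
    1 / (Nat.factorial 1 : ℕ) * 0) = 0 := by norm_num [Nat.factorial]
  rw [this] at e4
  refine squeeze_zero (fun n => measureReal_nonneg) (fun n => ?_) e4
  have := isProbabilityMeasure_networkLaw (n := n) (hR.le_pool n) (p n)
  have := real_eq_zero_le (networkLaw n (P n) (K n) (p n)) (degCount q h) (meanCount q K P p h n)
  simpa only [pow_one, Function.comp_apply] using this

end LogRegime

/-! ### The minimum degree -/

section MinDeg

variable {n P q : ℕ} {ω : Outcome n P}

lemma deg_eq_degree [DecidableRel (networkGraph q ω).Adj] (v : Fin n) :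
    deg q ω v = (networkGraph q ω).degree v := by
  rw [deg, ← SimpleGraph.card_neighborFinset_eq_degree, SimpleGraph.neighborFinset_eq_filter]
  congr

lemma minDeg_le_deg (v : Fin n) : minDeg q ω ≤ deg q ω v := by
  classical
  rw [deg_eq_degree]
  exact SimpleGraph.minDegree_le_degree _ v

lemma exists_deg_eq_minDeg (hn : 0 < n) : ∃ v : Fin n, deg q ω v = minDeg q ω := by
  classical
  have : Nonempty (Fin n) := ⟨⟨0, hn⟩⟩
  obtain ⟨v, hv⟩ := (networkGraph q ω).exists_minimal_degree_vertex
  exact ⟨v, by rw [deg_eq_degree]; exact hv.symm⟩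

lemma degCount_minDeg_ne_zero (hn : 0 < n) : degCount q (minDeg q ω) ω ≠ 0 := by
  obtain ⟨v, hv⟩ := exists_deg_eq_minDeg (q := q) (ω := ω) hn
  exact (card_pos.2 ⟨v, by simp [hv]⟩).ne'

lemma minDeg_le_of_degCount_ne_zero {h : ℕ} (hh : degCount q h ω ≠ 0) : minDeg q ω ≤ h := by
  obtain ⟨v, hv⟩ := card_pos.1 (Nat.pos_of_ne_zero hh)
  exact (mem_filter.1 hv).2 ▸ minDeg_le_deg v

end MinDeg

section Probability

variable {n P K q : ℕ} {p : unitInterval}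

lemma one_sub_real_eq (hKP : K ≤ P) (A : Set (Outcome n P)) :
    1 - (networkLaw n P K p).real A = (networkLaw n P K p).real Aᶜ := by
  have := isProbabilityMeasure_networkLaw (n := n) hKP p
  rw [probReal_compl_eq_one_sub (Set.toFinite _).measurableSet]

/-- The probability that the minimum degree is outside `{s, s + 1}`. -/
lemma real_minDeg_ne_le (hKP : K ≤ P) (hn : 0 < n) (s : ℕ) :
    (networkLaw n P K p).real {ω | ¬ (minDeg q ω = s + 1 ∨ minDeg q ω = s)} ≤
      ∑ h ∈ range s, (1 - (networkLaw n P K p).real {ω | degCount q h ω = 0}) +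
        (networkLaw n P K p).real {ω | degCount q (s + 1) ω = 0} := by
  have := isProbabilityMeasure_networkLaw (n := n) hKP p
  simp_rw [one_sub_real_eq hKP]
  -- Outside `{s, s + 1}` the minimum is either below `s`, and attained by some node, or at least `s
  -- + 2`, so that no node has degree `s + 1`.
  refine le_trans (measureReal_mono (s₂ := (⋃ h ∈ range s, {ω | degCount q h ω = 0}ᶜ) ∪
    {ω | degCount q (s + 1) ω = 0}) ?_) ((measureReal_union_le _ _).trans ?_)
  · intro ω hω
    simp only [Set.mem_ofPred_eq] at hω
    push Not at hω
    by_cases hs : minDeg q ω < s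
    · refine Or.inl ?_
      simp only [Set.mem_iUnion, mem_range]
      exact ⟨minDeg q ω, hs, degCount_minDeg_ne_zero hn⟩
    · refine Or.inr ?_
      by_contra hc
      have := minDeg_le_of_degCount_ne_zero hc
      omega
  · gcongr
    exact measureReal_biUnion_finset_le _ _

/-- When the minimum is known to be `s` or `s + 1`, it is `s + 1` exactly if no node has degree `s`.
-/
lemma abs_real_minDeg_eq_succ_sub_le (hKP : K ≤ P) (hn : 0 < n) (s : ℕ) :
    |(networkLaw n P K p).real {ω | minDeg q ω = s + 1} -
      (networkLaw n P K p).real {ω | degCount q s ω = 0}| ≤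
    (networkLaw n P K p).real {ω | ¬ (minDeg q ω = s + 1 ∨ minDeg q ω = s)} := by
  have := isProbabilityMeasure_networkLaw (n := n) hKP p
  rw [abs_sub_le_iff]
  constructor
  · have h1 : (networkLaw n P K p).real {ω | minDeg q ω = s + 1} ≤
        (networkLaw n P K p).real {ω | degCount q s ω = 0} := by
      refine measureReal_mono fun ω hω => ?_
      by_contra hc
      have := minDeg_le_of_degCount_ne_zero hc
      simp only [Set.mem_ofPred_eq] at hω
      omega
    have h2 : 0 ≤ (networkLaw n P K p).real {ω | ¬ (minDeg q ω = s + 1 ∨ minDeg q ω = s)} :=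
      measureReal_nonneg
    linarith
  · rw [sub_le_iff_le_add]
    refine le_trans (measureReal_mono ?_) (measureReal_union_le _ _)
    intro ω hω
    by_cases h : minDeg q ω = s + 1
    · exact Or.inr h
    · refine Or.inl ?_
      simp only [Set.mem_ofPred_eq] at hω ⊢
      rintro (h1 | h1)
      · exact h h1
      · exact degCount_minDeg_ne_zero (q := q) (ω := ω) hn (h1 ▸ hω)

lemma abs_real_minDeg_eq_sub_le (hKP : K ≤ P) (hn : 0 < n) (s : ℕ) :
    |(networkLaw n P K p).real {ω | minDeg q ω = s} -
      (1 - (networkLaw n P K p).real {ω | degCount q s ω = 0})| ≤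
    (networkLaw n P K p).real {ω | ¬ (minDeg q ω = s + 1 ∨ minDeg q ω = s)} := by
  have := isProbabilityMeasure_networkLaw (n := n) hKP p
  rw [one_sub_real_eq hKP, abs_sub_le_iff]
  constructor
  · have h1 : (networkLaw n P K p).real {ω | minDeg q ω = s} ≤
        (networkLaw n P K p).real {ω | degCount q s ω = 0}ᶜ := by
      refine measureReal_mono fun ω hω => ?_
      simp only [Set.mem_ofPred_eq] at hω
      exact hω ▸ degCount_minDeg_ne_zero hn
    have h2 : 0 ≤ (networkLaw n P K p).real {ω | ¬ (minDeg q ω = s + 1 ∨ minDeg q ω = s)} :=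
      measureReal_nonneg
    linarith
  · rw [sub_le_iff_le_add]
    refine le_trans (measureReal_mono ?_) (measureReal_union_le _ _)
    intro ω hω
    by_cases h : minDeg q ω = s
    · exact Or.inr h
    · refine Or.inl ?_
      have := minDeg_le_of_degCount_ne_zero hω
      simp only [Set.mem_ofPred_eq]
      omega

end Probability

/-! ### The mean number of nodes of a given degree -/

lemma tendsto_log_log_natCast : Tendsto (fun n : ℕ => Real.log (Real.log n)) atTop atTop :=
  Real.tendsto_log_atTop.comp tendsto_log_natCast

/-- The deviation is eventually smaller than a fixed fraction of `log log n`. -/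
lemma exists_abs_le_of_liminf_limsup {β : ℕ → ℝ}
    (hinf : (-1 : EReal) <
      liminf (fun n : ℕ => ((β n / Real.log (Real.log n) : ℝ) : EReal)) atTop)
    (hsup : limsup (fun n : ℕ => ((β n / Real.log (Real.log n) : ℝ) : EReal)) atTop <
      (1 : EReal)) :
    ∃ ε : ℝ, 0 < ε ∧ ∀ᶠ n : ℕ in atTop, |β n| ≤ (1 - ε) * Real.log (Real.log n) := by
  obtain ⟨c, hc1, hc2⟩ := EReal.lt_iff_exists_real_btwn.1 hinf
  obtain ⟨d, hd1, hd2⟩ := EReal.lt_iff_exists_real_btwn.1 hsup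
  have hc1 : -1 < c := EReal.coe_lt_coe_iff.1 (by simpa using hc1)
  have hd2 : d < 1 := by exact_mod_cast hd2
  refine ⟨min (1 + c) (1 - d), lt_min (by linarith) (by linarith), ?_⟩
  filter_upwards [eventually_lt_of_lt_liminf hc2, eventually_lt_of_limsup_lt hd1,
    tendsto_log_log_natCast.eventually_gt_atTop 0] with n h1 h2 hy
  have h1 : c < β n / Real.log (Real.log n) := by exact_mod_cast h1
  have h2 : β n / Real.log (Real.log n) < d := by exact_mod_cast h2
  rw [lt_div_iff₀ hy] at h1
  rw [div_lt_iff₀ hy] at h2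
  have e1 := min_le_left (1 + c) (1 - d)
  have e2 := min_le_right (1 + c) (1 - d)
  rw [abs_le]
  constructor <;> nlinarith

namespace LogRegime

variable {q : ℕ} {K P : ℕ → ℕ} {p : ℕ → unitInterval} {l : ℤ} {β : ℕ → ℝ}

/-- `n * exp (-x) = (log n) ^ (1 - l) * exp (-β n)`; writing `x ^ h` as `(x / log n) ^ h * (log n) ^
h` leaves a convergent prefactor and a single exponential. -/
lemma meanCount_eventually_eq (hx : ∀ᶠ n : ℕ in atTop, linkProb (P n) (K n) q (p n) =
      (Real.log n + ((l : ℝ) - 1) * Real.log (Real.log n) + β n) / n) (h : ℕ) :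
    meanCount q K P p h =ᶠ[atTop] fun n =>
      (n * linkProb (P n) (K n) q (p n) / Real.log n) ^ h / h.factorial *
        Real.exp ((h + 1 - l) * Real.log (Real.log n) - β n) := by
  filter_upwards [hx, tendsto_log_natCast.eventually_gt_atTop 0, eventually_gt_atTop 0]
    with n hn hL hn0
  have hn0 : (0 : ℝ) < n := by exact_mod_cast hn0
  set x := n * linkProb (P n) (K n) q (p n) with hxd
  have hx' : x = Real.log n + ((l : ℝ) - 1) * Real.log (Real.log n) + β n := by
    rw [hxd, hn]; field_simp
  have e1 : Real.exp ((h + 1 - l) * Real.log (Real.log n) - β n) =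
      Real.log n ^ h * (n * Real.exp (-x)) := by
    rw [show (h + 1 - l) * Real.log (Real.log n) - β n =
      h * Real.log (Real.log n) + (Real.log n + -x) by rw [hx']; ring, Real.exp_add, Real.exp_add,
      Real.exp_log hn0, Real.exp_nat_mul, Real.exp_log hL]
  rw [e1]
  unfold meanCount poissonMass
  rw [← hxd, div_pow]
  field_simp

lemma tendsto_prefactor (hR : LogRegime q K P p) (h : ℕ) : Tendsto (fun n : ℕ =>
    (n * linkProb (P n) (K n) q (p n) / Real.log n) ^ h / h.factorial) atTop
      (𝓝 (1 / h.factorial)) := by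
  have := (hR.mean_tendsto.pow h).div_const (h.factorial : ℝ)
  rwa [one_pow] at this

lemma tendsto_meanCount_of_exponent (hR : LogRegime q K P p)
    (hx : ∀ᶠ n : ℕ in atTop, linkProb (P n) (K n) q (p n) =
      (Real.log n + ((l : ℝ) - 1) * Real.log (Real.log n) + β n) / n) (h : ℕ) :
    (Tendsto (fun n : ℕ => ((h : ℝ) + 1 - l) * Real.log (Real.log n) - β n) atTop atTop →
      Tendsto (meanCount q K P p h) atTop atTop) ∧
    (Tendsto (fun n : ℕ => ((h : ℝ) + 1 - l) * Real.log (Real.log n) - β n) atTop atBot →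
      Tendsto (meanCount q K P p h) atTop (𝓝 0)) ∧
    (∀ c : ℝ, Tendsto (fun n : ℕ => ((h : ℝ) + 1 - l) * Real.log (Real.log n) - β n) atTop (𝓝 c) →
      Tendsto (meanCount q K P p h) atTop (𝓝 (Real.exp c / h.factorial))) := by
  refine ⟨fun he => ?_, fun he => ?_, fun c he => ?_⟩
  · exact ((hR.tendsto_prefactor h).pos_mul_atTop (by positivity)
      (Real.tendsto_exp_atTop.comp he)).congr' (meanCount_eventually_eq hx h).symm
  · have := (hR.tendsto_prefactor h).mul (Real.tendsto_exp_atBot.comp he)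
    rw [mul_zero] at this
    exact this.congr' (meanCount_eventually_eq hx h).symm
  · have := (hR.tendsto_prefactor h).mul ((Real.continuous_exp.tendsto c).comp he)
    rw [one_div_mul_eq_div] at this
    exact this.congr' (meanCount_eventually_eq hx h).symm

lemma tendsto_degCount_eq_zero_of_ge (hR : LogRegime q K P p)
    (hx : ∀ᶠ n : ℕ in atTop, linkProb (P n) (K n) q (p n) =
      (Real.log n + ((l : ℝ) - 1) * Real.log (Real.log n) + β n) / n)
    {ε : ℝ} (hε : 0 < ε) (hβ : ∀ᶠ n : ℕ in atTop, |β n| ≤ (1 - ε) * Real.log (Real.log n))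
    {h : ℕ} (hl : l ≤ h) :
    Tendsto (fun n => (networkLaw n (P n) (K n) (p n)).real {ω | degCount q h ω = 0}) atTop
      (𝓝 0) := by
  refine hR.tendsto_degCount_eq_zero_of_atTop h ((hR.tendsto_meanCount_of_exponent hx h).1 ?_)
  -- Here `h + 1 - l ≥ 1`, so after subtracting `β n` at least `ε * log log n` remains.
  refine tendsto_atTop_mono' _ ?_ (tendsto_log_log_natCast.const_mul_atTop hε)
  filter_upwards [hβ, tendsto_log_log_natCast.eventually_gt_atTop 0] with n hn hy
  have h1 : (l : ℝ) ≤ h := by exact_mod_cast hl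
  have := (abs_le.1 hn).2
  nlinarith

lemma tendsto_degCount_eq_zero_of_le (hR : LogRegime q K P p)
    (hx : ∀ᶠ n : ℕ in atTop, linkProb (P n) (K n) q (p n) =
      (Real.log n + ((l : ℝ) - 1) * Real.log (Real.log n) + β n) / n)
    {ε : ℝ} (hε : 0 < ε) (hβ : ∀ᶠ n : ℕ in atTop, |β n| ≤ (1 - ε) * Real.log (Real.log n))
    {h : ℕ} (hl : (h : ℤ) + 2 ≤ l) :
    Tendsto (fun n => (networkLaw n (P n) (K n) (p n)).real {ω | degCount q h ω = 0}) atTop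
      (𝓝 1) := by
  rw [← Real.exp_zero, ← neg_zero]
  refine hR.tendsto_degCount_eq_zero h ((hR.tendsto_meanCount_of_exponent hx h).2.1 ?_)
  -- Here `h + 1 - l ≤ -1`, and `-β n` can recover only `(1 - ε) * log log n`.
  refine tendsto_atBot_mono' _ ?_ (tendsto_log_log_natCast.const_mul_atTop_of_neg
    (neg_lt_zero.2 hε))
  filter_upwards [hβ, tendsto_log_log_natCast.eventually_gt_atTop 0] with n hn hy
  have h1 : (h : ℝ) + 2 ≤ l := by exact_mod_cast hl
  have := (abs_le.1 hn).1
  nlinarith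

end LogRegime

lemma tendsto_mean_div_log {q : ℕ} {K P : ℕ → ℕ} {p : ℕ → unitInterval} {l : ℤ} {β : ℕ → ℝ}
    (hx : ∀ᶠ n : ℕ in atTop, linkProb (P n) (K n) q (p n) =
      (Real.log n + ((l : ℝ) - 1) * Real.log (Real.log n) + β n) / n)
    {ε : ℝ} (hε : 0 < ε) (hβ : ∀ᶠ n : ℕ in atTop, |β n| ≤ (1 - ε) * Real.log (Real.log n)) :
    Tendsto (fun n : ℕ => n * linkProb (P n) (K n) q (p n) / Real.log n) atTop (𝓝 1) := by
  have h1 : Tendsto (fun n : ℕ => Real.log (Real.log n) / Real.log n) atTop (𝓝 0) :=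
    (Real.isLittleO_log_id_atTop.tendsto_div_nhds_zero).comp tendsto_log_natCast
  have h2 : Tendsto (fun n : ℕ => β n / Real.log n) atTop (𝓝 0) := by
    refine squeeze_zero_norm' ?_ h1
    filter_upwards [hβ, tendsto_log_natCast.eventually_gt_atTop 0,
      tendsto_log_log_natCast.eventually_gt_atTop 0] with n hn hL hy
    rw [norm_div, Real.norm_eq_abs, Real.norm_of_nonneg hL.le]
    refine div_le_div_of_nonneg_right (hn.trans ?_) hL.le
    nlinarith
  have h3 := ((h1.const_mul ((l : ℝ) - 1)).const_add 1).add h2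
  rw [mul_zero, add_zero, add_zero] at h3
  refine h3.congr' ?_
  filter_upwards [hx, tendsto_log_natCast.eventually_gt_atTop 0, eventually_gt_atTop 0]
    with n hn hL hn0
  have hn0 : (0 : ℝ) < n := by exact_mod_cast hn0
  rw [hn]
  field_simp

end QComposite

/-! ### From counts of low-degree nodes to the minimum degree -/

theorem theorem2 (q : ℕ) (hq : 1 ≤ q) (K P : ℕ → ℕ) (p : ℕ → unitInterval)
    (hKP : ∀ n, K n ≤ P n)
    -- `K_n = ω(1)` and `K_n² / P_n = o(1)`
    (hK : Tendsto K atTop atTop)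
    (hKP2 : Tendsto (fun n => (K n : ℝ) ^ 2 / (P n : ℝ)) atTop (𝓝 0))
    (k : ℕ) (hk : 1 ≤ k) (α : ℕ → ℝ)
    -- `α_n` has a limit in `[-∞, ∞]`
    (hα : ∃ a : EReal, Tendsto (fun n => (α n : EReal)) atTop (𝓝 a))
    (hlink : ∀ᶠ n : ℕ in atTop, QComposite.linkProb (P n) (K n) q (p n) =
      (Real.log n + ((k : ℝ) - 1) * Real.log (Real.log n) + α n) / n)
    (b : ℤ) (β : ℕ → ℝ)
    (hαβ : ∀ᶠ n : ℕ in atTop, α n = (b : ℝ) * Real.log (Real.log n) + β n)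
    (hinf : (-1 : EReal) <
      liminf (fun n : ℕ => ((β n / Real.log (Real.log n) : ℝ) : EReal)) atTop)
    (hsup : limsup (fun n : ℕ => ((β n / Real.log (Real.log n) : ℝ) : EReal)) atTop <
      (1 : EReal)) :
    let Pr : (n : ℕ) → Set (QComposite.Outcome n (P n)) → ℝ :=
      fun n A => (QComposite.networkLaw n (P n) (K n) (p n)).real A
    ((k : ℤ) + b ≤ 0 →
      Tendsto (fun n => Pr n {ω | QComposite.minDeg q ω = 0}) atTop (𝓝 1) ∧
      Tendsto (fun n => Pr n {ω | 0 < QComposite.minDeg q ω}) atTop (𝓝 0)) ∧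
    (1 ≤ (k : ℤ) + b →
      Tendsto (fun n => Pr n {ω | (QComposite.minDeg q ω : ℤ) = k + b ∨
        (QComposite.minDeg q ω : ℤ) = k + b - 1}) atTop (𝓝 1) ∧
      (∀ βlim : ℝ, Tendsto β atTop (𝓝 βlim) →
        Tendsto (fun n => Pr n {ω | (QComposite.minDeg q ω : ℤ) = k + b}) atTop
          (𝓝 (Real.exp (-(Real.exp (-βlim) / (Nat.factorial ((k : ℤ) + b - 1).toNat : ℝ))))) ∧
        Tendsto (fun n => Pr n {ω | (QComposite.minDeg q ω : ℤ) = k + b - 1}) atTop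
          (𝓝 (1 -
            Real.exp (-(Real.exp (-βlim) / (Nat.factorial ((k : ℤ) + b - 1).toNat : ℝ)))))) ∧
      (Tendsto β atTop atTop →
        Tendsto (fun n => Pr n {ω | (QComposite.minDeg q ω : ℤ) = k + b}) atTop (𝓝 1) ∧
        Tendsto (fun n => Pr n {ω | (QComposite.minDeg q ω : ℤ) ≠ k + b}) atTop (𝓝 0)) ∧
      (Tendsto β atTop atBot →
        Tendsto (fun n => Pr n {ω | (QComposite.minDeg q ω : ℤ) = k + b - 1}) atTop (𝓝 1) ∧
        Tendsto (fun n => Pr n {ω | (QComposite.minDeg q ω : ℤ) ≠ k + b - 1}) atTop (𝓝 0))) := by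
  intro Pr
  obtain ⟨ε, hε, hβ⟩ := QComposite.exists_abs_le_of_liminf_limsup hinf hsup
  have hx : ∀ᶠ n : ℕ in atTop, QComposite.linkProb (P n) (K n) q (p n) =
      (Real.log n + (((k + b : ℤ) : ℝ) - 1) * Real.log (Real.log n) + β n) / n := by
    filter_upwards [hlink, hαβ] with n h1 h2
    rw [h1, h2]; push_cast; ring
  have hR : QComposite.LogRegime q K P p :=
    ⟨hq, hKP, hK, hKP2, QComposite.tendsto_mean_div_log hx hε hβ⟩
  have hprob : ∀ n, IsProbabilityMeasure (QComposite.networkLaw n (P n) (K n) (p n)) :=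
    fun n => QComposite.isProbabilityMeasure_networkLaw (hKP n) (p n)
  have hcompl : ∀ (A : (n : ℕ) → Set (QComposite.Outcome n (P n))) (c : ℝ),
      Tendsto (fun n => Pr n (A n)) atTop (𝓝 c) →
      Tendsto (fun n => Pr n (A n)ᶜ) atTop (𝓝 (1 - c)) := fun A c h =>
    (h.const_sub 1).congr fun n => QComposite.one_sub_real_eq (hKP n) (A n)
  refine ⟨fun hl => ?_, fun hl => ?_⟩
  · have h0 := hR.tendsto_degCount_eq_zero_of_ge hx hε hβ (h := 0) (by exact_mod_cast hl)
    have h1 : Tendsto (fun n => Pr n {ω | 0 < QComposite.minDeg q ω}) atTop (𝓝 0) := by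
      refine squeeze_zero (fun n => measureReal_nonneg) (fun n => ?_) h0
      refine measureReal_mono fun ω hω => ?_
      by_contra hc
      have := QComposite.minDeg_le_of_degCount_ne_zero hc
      simp only [Set.mem_ofPred_eq] at hω
      omega
    refine ⟨?_, h1⟩
    have h2 := hcompl _ _ h1
    rw [sub_zero] at h2
    refine h2.congr fun n => congrArg _ ?_
    ext ω; simp
  -- `s = k + b - 1` is the critical degree; degrees below `s` are absent and degree `s + 1` is
  -- present with probability tending to one.
  · obtain ⟨s, hs⟩ : ∃ s : ℕ, (k : ℤ) + b = s + 1 :=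
      ⟨((k : ℤ) + b - 1).toNat, by rw [Int.toNat_of_nonneg (by omega)]; ring⟩
    have hs' : ((k : ℤ) + b - 1).toNat = s := by omega
    have hsR : ((k + b : ℤ) : ℝ) = s + 1 := by rw [hs]; push_cast; ring
    have c1 : ∀ d : ℕ, ((d : ℤ) = k + b) ↔ d = s + 1 := fun d => by omega
    have c2 : ∀ d : ℕ, ((d : ℤ) = k + b - 1) ↔ d = s := fun d => by omega
    simp only [ne_eq, c1, c2, hs']
    have hout : Tendsto (fun n => Pr n {ω | ¬ (QComposite.minDeg q ω = s + 1 ∨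
        QComposite.minDeg q ω = s)}) atTop (𝓝 0) := by
      have e1 : Tendsto (fun n => ∑ h ∈ Finset.range s, (1 - Pr n {ω | QComposite.degCount q h ω = 0}) +
          Pr n {ω | QComposite.degCount q (s + 1) ω = 0}) atTop (𝓝 0) := by
        have e2 : Tendsto (fun n => ∑ h ∈ Finset.range s,
            (1 - Pr n {ω | QComposite.degCount q h ω = 0})) atTop
            (𝓝 (∑ h ∈ Finset.range s, (1 - 1))) :=
          tendsto_finsetSum _ fun h hh =>
            (hR.tendsto_degCount_eq_zero_of_le hx hε hβ (by
              have := Finset.mem_range.1 hh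
              omega)).const_sub 1
        have e3 := e2.add (hR.tendsto_degCount_eq_zero_of_ge hx hε hβ (h := s + 1) (by
          push_cast; omega))
        simpa using e3
      refine squeeze_zero' (.of_forall fun n => measureReal_nonneg) ?_ e1
      filter_upwards [eventually_gt_atTop 0] with n hn
      exact QComposite.real_minDeg_ne_le (hKP n) hn s
    have hupper : ∀ c : ℝ, Tendsto (fun n => Pr n {ω | QComposite.degCount q s ω = 0}) atTop (𝓝 c) →
        Tendsto (fun n => Pr n {ω | QComposite.minDeg q ω = s + 1}) atTop (𝓝 c) := by
      intro c hc
      have := squeeze_zero_norm' (a := fun n => Pr n {ω | ¬ (QComposite.minDeg q ω = s + 1 ∨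
        QComposite.minDeg q ω = s)}) (f := fun n => Pr n {ω | QComposite.minDeg q ω = s + 1} -
        Pr n {ω | QComposite.degCount q s ω = 0}) (by
          filter_upwards [eventually_gt_atTop 0] with n hn
          exact QComposite.abs_real_minDeg_eq_succ_sub_le (hKP n) hn s) hout
      simpa using this.add hc
    have hlower : ∀ c : ℝ, Tendsto (fun n => Pr n {ω | QComposite.degCount q s ω = 0}) atTop (𝓝 c) →
        Tendsto (fun n => Pr n {ω | QComposite.minDeg q ω = s}) atTop (𝓝 (1 - c)) := by
      intro c hc
      have := squeeze_zero_norm' (a := fun n => Pr n {ω | ¬ (QComposite.minDeg q ω = s + 1 ∨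
        QComposite.minDeg q ω = s)}) (f := fun n => Pr n {ω | QComposite.minDeg q ω = s} -
        (1 - Pr n {ω | QComposite.degCount q s ω = 0})) (by
          filter_upwards [eventually_gt_atTop 0] with n hn
          exact QComposite.abs_real_minDeg_eq_sub_le (hKP n) hn s) hout
      simpa using this.add (hc.const_sub 1)
    have hexp := hR.tendsto_meanCount_of_exponent hx s
    -- At the critical degree the `log log n` term cancels, so the behaviour of `β` alone separates
    -- the last three cases.
    have hexp0 : ∀ n : ℕ, ((s : ℝ) + 1 - ((k + b : ℤ) : ℝ)) * Real.log (Real.log n) - β n =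
        -β n := fun n => by rw [hsR]; ring
    simp only [hexp0] at hexp
    refine ⟨?_, fun βlim hlim => ?_, fun hlim => ?_, fun hlim => ?_⟩
    · have h2 := hcompl _ _ hout
      rw [sub_zero] at h2
      refine h2.congr fun n => congrArg _ ?_
      ext ω; simp only [Set.mem_compl_iff, Set.mem_ofPred_eq, not_not]
    · have h := hR.tendsto_degCount_eq_zero s (hexp.2.2 _ hlim.neg)
      exact ⟨hupper _ h, hlower _ h⟩
    · have h := hR.tendsto_degCount_eq_zero s (hexp.2.1 (tendsto_neg_atTop_atBot.comp hlim))
      rw [neg_zero, Real.exp_zero] at h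
      have h2 := hcompl _ _ (hupper _ h)
      rw [sub_self] at h2
      exact ⟨hupper _ h, h2⟩
    · have h := hR.tendsto_degCount_eq_zero_of_atTop s
        (hexp.1 (tendsto_neg_atBot_atTop.comp hlim))
      have h1 := hlower _ h
      rw [sub_zero] at h1
      have h2 := hcompl _ _ h1
      rw [sub_self] at h2
      exact ⟨h1, h2⟩
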